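/- **Setting.** Inner products $(\cdot,\cdot)$ are linear in the first argument. Let $\dot A$ be a closed, densely defined, symmetric operator with finite equal deficiency indices in a complex Hilbert space $\mathcal H_1$. Let $\mathcal H_{+1}=\operatorname{dom}\dot A^*$ with inner product $(f,g)_+=(f,g)+(\dot A^*f,\dot A^*g)$, and let $\mathcal H_{+1}\subset\mathcal H_1\subset\mathcal H_{-1}$ be the associated rigged space, $\mathcal H_{-1}$ being the space of bounded antilinear functionals on $\mathcal H_{+1}$. For $\mathbb A\in[\mathcal H_{+1},\mathcal H_{-1}]$ the adjoint $\mathbb A^*\in[\mathcal H_{+1},\mathcal H_{-1}]$ is given by $(\mathbb A^*f,g)=(f,\mathbb Ag)$, and $\operatorname{Re}\mathbb A=\frac12(\mathbb A+\mathbb A^*)$, $\operatorname{Im}\mathbb A=\frac1{2i}(\mathbb A-\mathbb A^*)$. The quasi-kernel of $\mathbb A$ is the restriction of $\mathbb A$ to $\{f\in\mathcal H_{+1}:\mathbb Af\in\mathcal H_1\}$, as an operator in $\mathcal H_1$. An *L-system* $\Theta_L$ with input-output space $\mathbb C$ and direction operator $J=1$ consists of such an $\dot A$, an operator $\mathbb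 A\in[\mathcal H_{+1},\mathcal H_{-1}]$ and an operator $K_1\in[\mathbb C,\mathcal H_{-1}]$ with adjoint $K_1^*\in[\mathcal H_{+1},\mathbb C]$ such that $\operatorname{Im}\mathbb A=K_1K_1^*$, $\operatorname{ran}K_1=\operatorname{ran}\operatorname{Im}\mathbb A$, and $\mathbb A$ is a $(*)$-extension of a non-symmetric operator $T$ with $\dot A\subset T\subset\dot A^*$, $\rho(T)\neq\emptyset$ and $\operatorname{dom}\dot A=\operatorname{dom}T\cap\operatorname{dom}T^*$; that is, $\dot A\subset T\subset\mathbb A$, $\dot A\subset T^*\subset\mathbb A^*$, $\operatorname{Re}\mathbb A\supset\dot A$, and the quasi-kernel $\hat A$ of $\operatorname{Re}\mathbb A$ is self-adjoint. Its *impedance function* is $V_{\Theta_L}(z)=K_1^*(\operatorname{Re}\mathbb A-zI)^{-1}K_1$, $z\in\rho(\hat A)$. For $t\in\mathbb R$ let $\Theta^{(t)}$ be the array $(M,F,K)$ of the operators $M=t+i$, $F=0$, $K=1$ on $\mathbb C$. The *coupling* of two arrays $(M_j,F_j,K_j)$, $j=1,2$, is the array $$\left(\begin{pmatrix}M_1&2iK_1K_2^*\\0&M_2\end{pmatrix},\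 \begin{pmatrix}F_1&0\\0&F_2\end{pmatrix},\ \begin{pmatrix}K_1\\K_2\end{pmatrix}\right)$$ on the orthogonal sum of the two spaces. The *controller* $\Theta_{0,\alpha}$, $\alpha\in[0,\pi)$, is $\Theta^{(\tan\alpha)}$ if $\alpha\ne0,\frac\pi2$, while $\Theta_{0,0}=\Theta^{(-1)}\cdot\Theta^{(-1)}$ and $\Theta_{0,\pi/2}=\Theta^{(1)}\cdot\Theta^{(-1)}$. The *LF-coupling* $\Theta_{LF}=\Theta_L\cdot\Theta_{0,\alpha}$ with the controller $\Theta_{0,\alpha}=(M,F,K_2)$ on $\mathcal H_2$ consists of the operators $$\mathbb M=\begin{pmatrix}\mathbb A&2iK_1K_2^*\\0&M\end{pmatrix},\qquad \mathbb F=\begin{pmatrix}I&0\\0&F\end{pmatrix},\qquad K=\begin{pmatrix}K_1\\K_2\end{pmatrix}$$ over $\mathcal H_{+1}\oplus\mathcal H_2\subset\mathcal H_1\oplus\mathcal H_2\subset\mathcal H_{-1}\oplus\mathcal H_2$. Its impedance function is $V_{\Theta_{LF}}(z)=K^*(\operatorname{Re}\mathbb M-z\mathbb F)^{-1}K$, $z\in\rho(\operatorname{Re}\mathbb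 M,\mathbb F)$. Here $\rho(\operatorname{Re}\mathbb M,\mathbb F)$ is the set of $z$ for which the restriction of $\operatorname{Re}\mathbb M-z\mathbb F$ to the vectors of $\mathcal H_{+1}\oplus\mathcal H_2$ that it maps into $\mathcal H_1\oplus\mathcal H_2$ has an inverse that is bounded and defined on all of $\mathcal H_1\oplus\mathcal H_2$, and $V_{\Theta_{LF}}(z)$ is defined if moreover $\operatorname{ran}K\subset\operatorname{ran}(\operatorname{Re}\mathbb M-z\mathbb F)$. The same convention, with $\operatorname{Re}\mathbb A$ and $I$, is used for $V_{\Theta_L}$. The *Donoghue class* $\mathfrak M$ consists of all analytic maps $V:\mathbb C_+\to\mathbb C_+$ of the form $$V(z)=\int_{\mathbb R}\left(\frac1{\lambda-z}-\frac{\lambda}{1+\lambda^2}\right)d\mu(\lambda),\qquad \int_{\mathbb R}\frac{d\mu(\lambda)}{1+\lambda^2}=1,$$ with a Borel measure $\mu$ such that $\mu(\mathbb R)=\infty$. For impedance functions, membership in $\mathfrak M$ refers to their restrictions to $\mathbb C_+$. **Theorem.** Let $\Theta_L$ be an L-system with input-output space $\mathbb C$ and $J=1$ such that $V_{\Theta_L}\in\mathfrak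 M$, let $\alpha\in[0,\pi)$, and let $\Theta_{LF}=\Theta_L\cdot\Theta_{0,\alpha}$. Then $V_{\Theta_{LF}}$ is defined at every point of $\mathbb C_+$, and $V_{\Theta_{LF}}\in\mathfrak M$. -/

import Mathlib

open MeasureTheory

noncomputable section

/-! ### Rigged Hilbert spaces `V ⊂ H ⊂ V₋` -/

/-- The space `V₋` of bounded antilinear functionals on `V`. For `V = H₊` this is the negative
space `H₋`; the value `g f` is the pairing `(g, f)` of `g ∈ H₋` with `f ∈ H₊`, written in the
convention in which `(·,·)` is linear in its first and antilinear in its second argument. -/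
abbrev AntiDual (V : Type*) [NormedAddCommGroup V] [InnerProductSpace ℂ V] : Type _ :=
  V →L⋆[ℂ] ℂ

section Rigging

variable {V H E : Type*} [NormedAddCommGroup V] [InnerProductSpace ℂ V]
  [NormedAddCommGroup H] [InnerProductSpace ℂ H]
  [NormedAddCommGroup E] [InnerProductSpace ℂ E] [CompleteSpace E]

/-- The map `H → V₋` dual to a map `V → H`: `h` goes to the functional `f ↦ (h, emb f)_H`. If
`emb` is the inclusion `H₊ ⊂ H`, this is the inclusion `H ⊂ H₋`. -/
def toMinus (emb : V →L[ℂ] H) : H →L[ℂ] AntiDual V :=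
  ((ContinuousLinearMap.compSL V H ℂ (RingHom.id ℂ) (starRingEnd ℂ)).flip emb).comp
    (innerSL ℂ : H →L⋆[ℂ] H →L[ℂ] ℂ).flip

@[simp] theorem toMinus_apply (emb : V →L[ℂ] H) (h : H) (f : V) :
    toMinus emb h f = inner ℂ (emb f) h := rfl

/-- The adjoint `A* ∈ [V, V₋]` of `A ∈ [V, V₋]`: `(A* f, g) = (f, A g)`, the conjugate of
`(A g, f)`. -/
def biAdjoint (A : V →L[ℂ] AntiDual V) : V →L[ℂ] AntiDual V :=
  LinearMap.mkContinuous₂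
    (LinearMap.mk₂'ₛₗ (RingHom.id ℂ) (starRingEnd ℂ)
      (fun f g => (starRingEnd ℂ) (A g f))
      (by intro f f₁ g; simp) (by intro c f g; simp)
      (by intro f g g₁; simp) (by intro c f g; simp))
    ‖A‖ (by
      intro f g
      have h := A.le_opNorm₂ g f
      simp only [LinearMap.mk₂'ₛₗ_apply, RCLike.norm_conj]
      linarith [mul_right_comm ‖A‖ ‖g‖ ‖f‖])

@[simp] theorem biAdjoint_apply (A : V →L[ℂ] AntiDual V) (f g : V) :
    biAdjoint A f g = (starRingEnd ℂ) (A g f) := rfl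

/-- The real part `Re A = (A + A*) / 2`. -/
def biRe (A : V →L[ℂ] AntiDual V) : V →L[ℂ] AntiDual V :=
  (1 / 2 : ℂ) • (A + biAdjoint A)

/-- The imaginary part `Im A = (A - A*) / (2i)`. -/
def biIm (A : V →L[ℂ] AntiDual V) : V →L[ℂ] AntiDual V :=
  (1 / (2 * Complex.I) : ℂ) • (A - biAdjoint A)

/-- The adjoint `K* ∈ [V, E]` of `K ∈ [E, V₋]`: `(K* f, e)_E = (f, K e)`. -/
def chanAdjoint (K : E →L[ℂ] AntiDual V) : V →L[ℂ] E :=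
  ((InnerProductSpace.toDual ℂ E).symm.toContinuousLinearEquiv :
    (E →L[ℂ] ℂ) →L⋆[ℂ] E).comp K.flip

theorem inner_chanAdjoint (K : E →L[ℂ] AntiDual V) (f : V) (e : E) :
    inner ℂ (chanAdjoint K f) e = K e f := by
  simp [chanAdjoint]

end Rigging

/-- The array `(M, F, K)` over a rigged space `V ⊂ H ⊂ V₋` which underlies a system with input-output
space `E`: the inclusion of `V` in `H`, `M ∈ [V, V₋]`, `F ∈ [H, H]` and `K ∈ [E, V₋]`. (The direction
operator does not enter the impedance function, so it is not recorded here.) -/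
structure RiggedArray (V H E : Type*) [NormedAddCommGroup V] [InnerProductSpace ℂ V]
    [NormedAddCommGroup H] [InnerProductSpace ℂ H]
    [NormedAddCommGroup E] [InnerProductSpace ℂ E] where
  emb : V →L[ℂ] H
  M : V →L[ℂ] AntiDual V
  F : H →L[ℂ] H
  K : E →L[ℂ] AntiDual V

namespace RiggedArray

variable {V H E : Type*} [NormedAddCommGroup V] [InnerProductSpace ℂ V]
  [NormedAddCommGroup H] [InnerProductSpace ℂ H]
  [NormedAddCommGroup E] [InnerProductSpace ℂ E] [CompleteSpace E]

/-- The operator `Re M - z F ∈ [V, V₋]`. -/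
def rePencil (S : RiggedArray V H E) (z : ℂ) : V →L[ℂ] AntiDual V :=
  biRe S.M - z • (toMinus S.emb).comp (S.F.comp S.emb)

/-- The resolvent set `ρ(Re M, F)`: the points `z` such that `Re M - z F`, restricted to those
vectors of `V` which it maps into `H`, has an inverse that is defined on all of `H` and
bounded in `H`. (For `F = I` it is the resolvent set of the quasi-kernel of `Re M`.) -/
def reResolventSet (S : RiggedArray V H E) : Set ℂ :=
  {z | (∀ h : H, ∃! x : V, S.rePencil z x = toMinus S.emb h) ∧
    ∃ C : ℝ, ∀ (x : V) (h : H), S.rePencil z x = toMinus S.emb h → ‖S.emb x‖ ≤ C * ‖h‖}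

/-- The impedance function is defined at `z`: `z ∈ ρ(Re M, F)` and `(Re M - z F)⁻¹ K` makes sense,
that is, the range of `K` lies in the range of `Re M - z F`. -/
def ImpedanceDefinedAt (S : RiggedArray V H E) (z : ℂ) : Prop :=
  z ∈ S.reResolventSet ∧ ∀ e : E, ∃ x : V, S.rePencil z x = S.K e

open Classical in
/-- The impedance function `V(z) = K* (Re M - z F)⁻¹ K`, with the value `0` at the points where it is
not defined. (For `z ∈ ρ(Re M, F)` the solution `x` of `(Re M - z F) x = K e` is unique.) -/
def impedance (S : RiggedArray V H E) (z : ℂ) (e : E) : E :=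
  if h : S.ImpedanceDefinedAt z then chanAdjoint S.K (h.2 e).choose else 0

/-- The impedance function of a system with input-output space `ℂ`, as a scalar function. -/
def scalarImpedance (S : RiggedArray V H ℂ) (z : ℂ) : ℂ := S.impedance z 1

end RiggedArray

/-! ### Operators between a symmetric operator and its adjoint -/

section Operators

variable {H : Type*} [NormedAddCommGroup H] [InnerProductSpace ℂ H] [CompleteSpace H]

/-- `z ∈ ρ(T)`: `T - z I` is a bijection of the domain of `T` onto `H` with bounded inverse. -/
def opResolventSet (T : H →ₗ.[ℂ] H) : Set ℂ :=
  {z | (∀ h : H, ∃! x : T.domain, T x - z • (x : H) = h) ∧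
    ∃ C : ℝ, ∀ x : T.domain, ‖(x : H)‖ ≤ C * ‖T x - z • (x : H)‖}

/-- The kernel of `A* - z I`. -/
def deficiencySubspace (A : H →ₗ.[ℂ] H) (z : ℂ) : Submodule ℂ H :=
  (LinearMap.ker (A.adjoint.toFun - z • A.adjoint.domain.subtype)).map A.adjoint.domain.subtype

/-- The space `H₊ = dom A*` with inner product `(f, g) + (A* f, A* g)`, realized as the graph
`{(f, A* f)}` of `A*` inside the Hilbert sum `H ⊕ H`. -/
def PlusSpace (A : H →ₗ.[ℂ] H) : Submodule ℂ (WithLp 2 (H × H)) :=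
  A.adjoint.graph.map (WithLp.linearEquiv 2 ℂ (H × H)).symm.toLinearMap

/-- The inclusion `H₊ ⊂ H`. -/
def plusEmb (A : H →ₗ.[ℂ] H) : PlusSpace A →L[ℂ] H :=
  (WithLp.fstL 2 ℂ H H).comp (PlusSpace A).subtypeL

/-- `T ⊂ 𝔸` for an operator `T` in `H` and `𝔸 ∈ [H₊, H₋]`: the domain of `T` lies in `H₊`, and
`𝔸 f = T f` (an element of `H ⊂ H₋`) for `f` in it. -/
def BiExtends {A : H →ₗ.[ℂ] H} (B : PlusSpace A →L[ℂ] AntiDual (PlusSpace A))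
    (T : H →ₗ.[ℂ] H) : Prop :=
  T.domain ≤ A.adjoint.domain ∧
    ∀ (x : PlusSpace A) (t : T.domain), plusEmb A x = (t : H) → B x = toMinus (plusEmb A) (T t)

/-- The graph `{(f, h) : f ∈ H₊, 𝔸 f = h ∈ H}` of the quasi-kernel of `𝔸`. -/
def quasiKernelGraph {A : H →ₗ.[ℂ] H} (B : PlusSpace A →L[ℂ] AntiDual (PlusSpace A)) :
    Submodule ℂ (H × H) where
  carrier := {p | ∃ x : PlusSpace A, plusEmb A x = p.1 ∧ B x = toMinus (plusEmb A) p.2}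
  add_mem' := by
    rintro p q ⟨x, hx, hx'⟩ ⟨y, hy, hy'⟩
    exact ⟨x + y, by simp [hx, hy], by simp [hx', hy']⟩
  zero_mem' := ⟨0, by simp, by simp⟩
  smul_mem' := by
    rintro c p ⟨x, hx, hx'⟩
    exact ⟨c • x, by simp [hx], by simp [hx']⟩

/-- The quasi-kernel of `𝔸 ∈ [H₊, H₋]`: the restriction of `𝔸` to `{f ∈ H₊ : 𝔸 f ∈ H}`. -/
def quasiKernel {A : H →ₗ.[ℂ] H} (B : PlusSpace A →L[ℂ] AntiDual (PlusSpace A)) : H →ₗ.[ℂ] H :=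
  (quasiKernelGraph B).toLinearPMap

/-- `A` is a closed, densely defined, symmetric operator with finite equal deficiency indices. -/
structure IsAdmissibleSymmetric (A : H →ₗ.[ℂ] H) : Prop where
  closed : A.IsClosed
  dense : Dense (A.domain : Set H)
  symmetric : A.IsFormalAdjoint A
  finite_pos : FiniteDimensional ℂ (deficiencySubspace A Complex.I)
  finite_neg : FiniteDimensional ℂ (deficiencySubspace A (-Complex.I))
  finrank_eq : Module.finrank ℂ (deficiencySubspace A Complex.I) =
    Module.finrank ℂ (deficiencySubspace A (-Complex.I))

/-- `T` belongs to the class `Λ(A)`: it is a non-symmetric operator with `A ⊂ T ⊂ A*`, its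
resolvent set is nonempty, and `dom A = dom T ∩ dom T*`. -/
structure IsClassLambda (A T : H →ₗ.[ℂ] H) : Prop where
  le : A ≤ T
  le_adjoint : T ≤ A.adjoint
  not_symmetric : ¬ T.IsFormalAdjoint T
  resolvent_nonempty : (opResolventSet T).Nonempty
  domain_eq : A.domain = T.domain ⊓ T.adjoint.domain

/-- `𝔸` is a (∗)-extension of `T`: `A ⊂ T ⊂ 𝔸`, `A ⊂ T* ⊂ 𝔸*`, and `Re 𝔸` is a t-self-adjoint
bi-extension of `A`, that is, a self-adjoint bi-extension with self-adjoint quasi-kernel. -/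
structure IsStarExtension {A : H →ₗ.[ℂ] H} (B : PlusSpace A →L[ℂ] AntiDual (PlusSpace A))
    (T : H →ₗ.[ℂ] H) : Prop where
  le : A ≤ T
  le_adjoint : A ≤ T.adjoint
  extends_main : BiExtends B T
  extends_adjoint : BiExtends (biAdjoint B) T.adjoint
  re_selfAdjoint : biAdjoint (biRe B) = biRe B
  re_extends : BiExtends (biRe B) A
  quasiKernel_selfAdjoint : IsSelfAdjoint (quasiKernel (biRe B))

end Operators

/-! ### L-systems, F-systems and their coupling -/

/-- An L-system with state space `H`, finite-dimensional input-output space `E` and direction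
operator `J`. -/
structure LSystem (H E : Type*) [NormedAddCommGroup H] [InnerProductSpace ℂ H] [CompleteSpace H]
    [NormedAddCommGroup E] [InnerProductSpace ℂ E] [CompleteSpace E] [FiniteDimensional ℂ E]
    (J : E →L[ℂ] E) where
  /-- the underlying symmetric operator, which determines the rigged space -/
  symOp : H →ₗ.[ℂ] H
  symOp_admissible : IsAdmissibleSymmetric symOp
  /-- the main operator -/
  mainOp : H →ₗ.[ℂ] H
  mainOp_lambda : IsClassLambda symOp mainOp
  /-- the state-space operator -/
  stateOp : PlusSpace symOp →L[ℂ] AntiDual (PlusSpace symOp)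
  stateOp_star : IsStarExtension stateOp mainOp
  J_adjoint : J.adjoint = J
  J_sq : J.comp J = 1
  /-- the channel operator -/
  K : E →L[ℂ] AntiDual (PlusSpace symOp)
  im_stateOp : biIm stateOp = K.comp (J.comp (chanAdjoint K))
  range_K : Set.range K = Set.range (biIm stateOp)

/-- The algebraic part of the definition of an F-system with input-output space `E` and direction
operator `J`: bounded operators `M` and `F` on a Hilbert space `X` and `K ∈ [E, X]` with
`Im M = K J K*` and `F` an orthogonal projection. The requirement that `ρ(M, F)` and `ρ(Re M, F)` are
nonempty is not included: the coupling of two F-systems always has the properties listed here, but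
`ρ(Re M, F)` may become empty. -/
structure FSystem (E : Type*) [NormedAddCommGroup E] [InnerProductSpace ℂ E] [CompleteSpace E]
    (J : E →L[ℂ] E) where
  X : Type
  [instNormed : NormedAddCommGroup X]
  [instInner : InnerProductSpace ℂ X]
  [instComplete : CompleteSpace X]
  M : X →L[ℂ] X
  F : X →L[ℂ] X
  K : E →L[ℂ] X
  J_adjoint : J.adjoint = J
  J_sq : J.comp J = 1
  im_M : (1 / (2 * Complex.I) : ℂ) • (M - M.adjoint) = K.comp (J.comp K.adjoint)
  F_proj : IsStarProjection F

attribute [instance] FSystem.instNormed FSystem.instInner FSystem.instComplete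

/-- The identification of `V₋ ⊕ X` with `(V ⊕ X)₋`, for a Hilbert space `X`. -/
def sumMinus (V X : Type*) [NormedAddCommGroup V] [InnerProductSpace ℂ V]
    [NormedAddCommGroup X] [InnerProductSpace ℂ X] :
    (AntiDual V × X) →L[ℂ] AntiDual (WithLp 2 (V × X)) :=
  ((ContinuousLinearMap.compSL (WithLp 2 (V × X)) V ℂ (RingHom.id ℂ) (starRingEnd ℂ)).flip
    (WithLp.fstL 2 ℂ V X)).coprod (toMinus (WithLp.sndL 2 ℂ V X))

theorem sumMinus_apply {V X : Type*} [NormedAddCommGroup V] [InnerProductSpace ℂ V]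
    [NormedAddCommGroup X] [InnerProductSpace ℂ X] (g : AntiDual V) (y : X)
    (f : WithLp 2 (V × X)) : sumMinus V X (g, y) f = g f.fst + inner ℂ f.snd y := rfl

/-- The block operator with rows `(a, b)` and `(0, d)` on a Hilbert sum `X ⊕ Y`, with values in
a product. -/
def blockUpper {X Y X' Y' : Type*} [NormedAddCommGroup X] [InnerProductSpace ℂ X]
    [NormedAddCommGroup Y] [InnerProductSpace ℂ Y] [NormedAddCommGroup X'] [NormedSpace ℂ X']
    [NormedAddCommGroup Y'] [NormedSpace ℂ Y']
    (a : X →L[ℂ] X') (b : Y →L[ℂ] X') (d : Y →L[ℂ] Y') : WithLp 2 (X × Y) →L[ℂ] X' × Y' :=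
  (a.comp (WithLp.fstL 2 ℂ X Y) + b.comp (WithLp.sndL 2 ℂ X Y)).prod
    (d.comp (WithLp.sndL 2 ℂ X Y))

/-- The identity map from the product `X × Y` to the Hilbert sum `X ⊕ Y`. -/
def toLpSum (X Y : Type*) [NormedAddCommGroup X] [InnerProductSpace ℂ X]
    [NormedAddCommGroup Y] [InnerProductSpace ℂ Y] : X × Y →L[ℂ] WithLp 2 (X × Y) :=
  (WithLp.prodContinuousLinearEquiv 2 ℂ X Y).symm

section Coupling

variable {H E : Type*} [NormedAddCommGroup H] [InnerProductSpace ℂ H] [CompleteSpace H]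
  [NormedAddCommGroup E] [InnerProductSpace ℂ E] [CompleteSpace E]
  {J : E →L[ℂ] E}

theorem toLpSum_fst {X Y : Type*} [NormedAddCommGroup X] [InnerProductSpace ℂ X]
    [NormedAddCommGroup Y] [InnerProductSpace ℂ Y] (p : X × Y) : (toLpSum X Y p).fst = p.1 := rfl

theorem toLpSum_snd {X Y : Type*} [NormedAddCommGroup X] [InnerProductSpace ℂ X]
    [NormedAddCommGroup Y] [InnerProductSpace ℂ Y] (p : X × Y) : (toLpSum X Y p).snd = p.2 := rfl

theorem blockUpper_apply {X Y X' Y' : Type*} [NormedAddCommGroup X] [InnerProductSpace ℂ X]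
    [NormedAddCommGroup Y] [InnerProductSpace ℂ Y] [NormedAddCommGroup X'] [NormedSpace ℂ X']
    [NormedAddCommGroup Y'] [NormedSpace ℂ Y']
    (a : X →L[ℂ] X') (b : Y →L[ℂ] X') (d : Y →L[ℂ] Y') (x : WithLp 2 (X × Y)) :
    blockUpper a b d x = (a x.fst + b x.snd, d x.snd) := rfl

theorem FSystem.inner_M_sub (Θ : FSystem E J) (v u : Θ.X) :
    inner ℂ v (Θ.M u) - inner ℂ (Θ.M v) u =
      (2 * Complex.I) * inner ℂ (Θ.K.adjoint v) (J (Θ.K.adjoint u)) := by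
  have h := congrArg (fun L : Θ.X →L[ℂ] Θ.X => inner ℂ v (L u)) Θ.im_M
  simp only [smul_apply, sub_apply, inner_smul_right,
    inner_sub_right, ContinuousLinearMap.adjoint_inner_right,
    ContinuousLinearMap.comp_apply] at h
  rw [← ContinuousLinearMap.adjoint_inner_left Θ.K] at h
  rw [← h]
  have : (2 * Complex.I) ≠ 0 := by simp
  field_simp

theorem adjoint_toLpSum_prod {X Y : Type*} [NormedAddCommGroup X] [InnerProductSpace ℂ X]
    [CompleteSpace X] [NormedAddCommGroup Y] [InnerProductSpace ℂ Y] [CompleteSpace Y]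
    (a : E →L[ℂ] X) (b : E →L[ℂ] Y) (x : WithLp 2 (X × Y)) :
    ((toLpSum X Y).comp (a.prod b)).adjoint x = a.adjoint x.fst + b.adjoint x.snd := by
  refine ext_inner_left ℂ fun v => ?_
  rw [ContinuousLinearMap.adjoint_inner_right, inner_add_right,
    ContinuousLinearMap.adjoint_inner_right, ContinuousLinearMap.adjoint_inner_right,
    WithLp.prod_inner_apply]
  rfl

/-- The coupling `Θ₁ · Θ₂` of two F-systems. -/
def FSystem.mul (Θ₁ Θ₂ : FSystem E J) : FSystem E J where
  X := WithLp 2 (Θ₁.X × Θ₂.X)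
  M := (toLpSum Θ₁.X Θ₂.X).comp
    (blockUpper Θ₁.M ((2 * Complex.I) • Θ₁.K.comp (J.comp Θ₂.K.adjoint)) Θ₂.M)
  F := (toLpSum Θ₁.X Θ₂.X).comp
    (blockUpper Θ₁.F 0 Θ₂.F)
  K := (toLpSum Θ₁.X Θ₂.X).comp (Θ₁.K.prod Θ₂.K)
  J_adjoint := Θ₁.J_adjoint
  J_sq := Θ₁.J_sq
  im_M := by
    ext1 u
    refine ext_inner_left ℂ fun v => ?_
    have h₁ := Θ₁.inner_M_sub v.fst u.fst
    have h₂ := Θ₂.inner_M_sub v.snd u.snd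
    have hJ : ∀ a b : E, inner ℂ (J a) b = inner ℂ a (J b) := fun a b => by
      rw [← ContinuousLinearMap.adjoint_inner_right, Θ₁.J_adjoint]
    simp only [smul_apply, sub_apply, inner_smul_right,
      inner_sub_right, ContinuousLinearMap.adjoint_inner_right]
    rw [ContinuousLinearMap.comp_apply ((toLpSum Θ₁.X Θ₂.X).comp (Θ₁.K.prod Θ₂.K)),
      ← ContinuousLinearMap.adjoint_inner_left ((toLpSum Θ₁.X Θ₂.X).comp (Θ₁.K.prod Θ₂.K)),
      ContinuousLinearMap.comp_apply J, adjoint_toLpSum_prod, adjoint_toLpSum_prod]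
    simp only [WithLp.prod_inner_apply, ContinuousLinearMap.comp_apply, blockUpper_apply]
    simp only [WithLp.ofLp_fst, WithLp.ofLp_snd, toLpSum_fst, toLpSum_snd,
      smul_apply, ContinuousLinearMap.comp_apply, inner_add_left,
      inner_add_right, inner_smul_left, inner_smul_right, map_add,
      ← ContinuousLinearMap.adjoint_inner_left Θ₁.K]
    rw [← ContinuousLinearMap.adjoint_inner_right Θ₁.K (J (Θ₂.K.adjoint v.snd)) u.fst, hJ]
    have h2I : (2 * Complex.I) ≠ 0 := by simp
    have hc : (starRingEnd ℂ) (2 * Complex.I) = -(2 * Complex.I) := by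
      rw [map_mul, map_ofNat, Complex.conj_I, mul_neg]
    rw [hc, one_div, inv_mul_eq_iff_eq_mul₀ h2I]
    linear_combination h₁ + h₂
  F_proj := by
    have h₁ := Θ₁.F_proj
    have h₂ := Θ₂.F_proj
    have hi₁ : ∀ x, Θ₁.F (Θ₁.F x) = Θ₁.F x := fun x => DFunLike.congr_fun h₁.isIdempotentElem x
    have hi₂ : ∀ x, Θ₂.F (Θ₂.F x) = Θ₂.F x := fun x => DFunLike.congr_fun h₂.isIdempotentElem x
    have hs₁ : ∀ a b, inner ℂ (Θ₁.F a) b = inner ℂ a (Θ₁.F b) :=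
      (ContinuousLinearMap.isSelfAdjoint_iff_isSymmetric.mp h₁.isSelfAdjoint)
    have hs₂ : ∀ a b, inner ℂ (Θ₂.F a) b = inner ℂ a (Θ₂.F b) :=
      (ContinuousLinearMap.isSelfAdjoint_iff_isSymmetric.mp h₂.isSelfAdjoint)
    refine ⟨?_, ContinuousLinearMap.isSelfAdjoint_iff_isSymmetric.mpr ?_⟩
    · ext1 x
      have h : ∀ y : WithLp 2 (Θ₁.X × Θ₂.X),
          (toLpSum Θ₁.X Θ₂.X).comp (blockUpper Θ₁.F 0 Θ₂.F) y =
            toLpSum Θ₁.X Θ₂.X (Θ₁.F y.fst, Θ₂.F y.snd) := fun y => by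
        simp [blockUpper_apply]
      rw [mul_apply_eq_comp, h, h, toLpSum_fst, toLpSum_snd, hi₁, hi₂]
    · intro x y
      simp [WithLp.prod_inner_apply, blockUpper_apply, toLpSum_fst, toLpSum_snd, hs₁, hs₂]

/-- The coupling of the array `(𝔸, F₁, K₁)` over `V ⊂ H ⊂ V₋` with an F-system, over
`V ⊕ X ⊂ H ⊕ X ⊂ V₋ ⊕ X`: the new operator `M` has the rows `(𝔸, 2i K₁ J K₂*)` and `(0, M)`, the new
operator `F` has the rows `(F₁, 0)` and `(0, F)`, and the new `K` has the rows `K₁` and `K₂`. -/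
def RiggedArray.couple {V H' : Type*} [NormedAddCommGroup V] [InnerProductSpace ℂ V]
    [NormedAddCommGroup H'] [InnerProductSpace ℂ H'] (S : RiggedArray V H' E) (Φ : FSystem E J) :
    RiggedArray (WithLp 2 (V × Φ.X)) (WithLp 2 (H' × Φ.X)) E where
  emb := (toLpSum H' Φ.X).comp (blockUpper S.emb 0 1)
  M := (sumMinus V Φ.X).comp
    (blockUpper S.M ((2 * Complex.I) • S.K.comp (J.comp Φ.K.adjoint)) Φ.M)
  F := (toLpSum H' Φ.X).comp (blockUpper S.F 0 Φ.F)
  K := (sumMinus V Φ.X).comp (S.K.prod Φ.K)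

variable [FiniteDimensional ℂ E]

/-- The array `(𝔸, I, K)` of an L-system over `H₊ ⊂ H ⊂ H₋`. -/
def LSystem.toArray (Θ : LSystem H E J) : RiggedArray (PlusSpace Θ.symOp) H E where
  emb := plusEmb Θ.symOp
  M := Θ.stateOp
  F := 1
  K := Θ.K

/-- The LF-coupling `Θ_L · Θ_F`. -/
def LSystem.coupling (Θ : LSystem H E J) (Φ : FSystem E J) :
    RiggedArray (WithLp 2 (PlusSpace Θ.symOp × Φ.X)) (WithLp 2 (H × Φ.X)) E :=
  Θ.toArray.couple Φ

end Coupling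

/-! ### Controllers -/

/-- The F-system with state space `ℂ`, main operator `t + i`, `F = 0`, `K = 1` and `J = 1`. -/
def basicController (t : ℝ) : FSystem ℂ (1 : ℂ →L[ℂ] ℂ) where
  X := ℂ
  M := ((t : ℂ) + Complex.I) • (1 : ℂ →L[ℂ] ℂ)
  F := 0
  K := 1
  J_adjoint := star_one _
  J_sq := rfl
  im_M := by
    have h1 : ContinuousLinearMap.adjoint (1 : ℂ →L[ℂ] ℂ) = 1 := star_one _
    have h2 : (2 * Complex.I) ≠ 0 := by simp
    rw [map_smulₛₗ, h1]
    ext1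
    simp
    field_simp
    simp [Complex.I_sq]
    norm_num
  F_proj := ⟨mul_zero _, star_zero _⟩

/-- The controller `Θ_{0,α}`, whose transfer function is the constant `-exp(2iα)`. For `α ≠ 0, π/2` its
main operator is `tan α + i`; for `α = 0` and `α = π/2` it is the coupling of two such
controllers, according to `-1 = i · i` and `1 = (-i) · i`. -/
def controller (α : ℝ) : FSystem ℂ (1 : ℂ →L[ℂ] ℂ) :=
  if α = 0 then
    (basicController (Real.tan (3 * Real.pi / 4))).mul (basicController (Real.tan (3 * Real.pi / 4)))
  else if α = Real.pi / 2 then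
    (basicController (Real.tan (Real.pi / 4))).mul (basicController (Real.tan (3 * Real.pi / 4)))
  else basicController (Real.tan α)

/-! ### The Donoghue class -/

/-- The function `f`, considered on the open upper half-plane, belongs to the Donoghue class: it maps
the half-plane analytically into itself and is the integral of
`1 / (λ - z) - λ / (1 + λ²)` with respect to an infinite Borel measure `μ` on `ℝ` such that the integral
of `1 / (1 + λ²)` is `1`. -/
def IsDonoghue (f : ℂ → ℂ) : Prop :=
  DifferentiableOn ℂ f {z | 0 < z.im} ∧ (∀ z : ℂ, 0 < z.im → 0 < (f z).im) ∧
    ∃ μ : Measure ℝ, μ Set.univ = ⊤ ∧ ∫⁻ t, ENNReal.ofReal (1 / (1 + t ^ 2)) ∂μ = 1 ∧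
      ∀ z : ℂ, 0 < z.im →
        f z = ∫ t : ℝ, (1 / ((t : ℂ) - z) - (t : ℂ) / (1 + (t : ℂ) ^ 2)) ∂μ

end

/-! ### The Herglotz representation in the unit disc -/

section Disc

open Complex Metric Filter Topology

/-! Write `v` for the value of the impedance of `Θ_L` at `z`. All controllers have `F = 0`, so the
second row of `Re 𝕄 - z𝔽` does not contain `z`. Eliminating the first row with the solution `ξ` of
`(Re 𝔸 - z) ξ = K₁ 1` leaves the finite-dimensional Schur complement `Re M - v K₂ K₂*`, and the
coupling has impedance `v + (1 + v²) K₂* (Re M - v K₂ K₂*)⁻¹ K₂` (`RiggedArray.couple_impedance`).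
For `Θ^(t)` this is `(t v + 1) / (t - v)`; the two product controllers give `-1 / v` and `v`. The
Schur complements are invertible because `Im v > 0`.

It remains to see that `v ↦ (t v + 1) / (t - v)`, with `t` real, preserves the Donoghue class
(`IsDonoghue.moebius`). This map is an automorphism of the half-plane fixing `i`. Putting `dρ = dμ /
(1 + λ²)` describes the class as the transforms `∫ (1 + λ z) / (λ - z) dρ` of probability measures
with `∫ (1 + λ²) dρ = ∞`. The image `W` of `f` again fixes `i`, so Herglotz's theorem gives `W(z) =
b z + ∫ (1 + λ z) / (λ - z) dρ` with `b + ρ(ℝ) = 1`. Behaviour along `i y`, `y → ∞`, rules out `b >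
0` and a finite integral of `1 + λ²`: either one would force `y Im f(iy)` to converge or `f(iy) / y`
to have a nonzero limit, while `f` in the class allows neither.

The Herglotz representation itself is derived on the disc, by weak compactness of probability
measures on the circle, and carried over by the Cayley transform. -/

theorem herglotz_eq_circleAverage_re {f : ℂ → ℂ} {R : ℝ}
    (hf : DiffContOnCl ℂ f (ball 0 R)) (h0 : (f 0).im = 0) {w : ℂ} (hw : w ∈ ball 0 R) :
    f w = Real.circleAverage (fun ζ ↦ herglotzRieszKernel 0 w ζ • ((f ζ).re : ℂ)) 0 R := by
  have hR : 0 < R := pos_of_mem_ball hw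
  have hcont : ContinuousOn f (sphere 0 R) :=
    hf.continuousOn.mono (by rw [closure_ball _ hR.ne']; exact sphere_subset_closedBall)
  have hre : CircleIntegrable (fun ζ ↦ (f ζ).re) 0 R :=
    (continuous_re.comp_continuousOn hcont).circleIntegrable hR.le
  have hreC : CircleIntegrable (fun ζ ↦ ((f ζ).re : ℂ)) 0 R :=
    ((continuous_ofReal.comp continuous_re).comp_continuousOn hcont).circleIntegrable hR.le
  have hdiff := differentiableOn_circleAverage_herglotzRieszKernel_smul hreC
  set g : ℂ → ℂ := fun w ↦ Real.circleAverage
    (fun ζ ↦ herglotzRieszKernel 0 w ζ • ((f ζ).re : ℂ)) 0 R with hg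
  -- The real part of the Herglotz–Riesz kernel is the Poisson kernel, which reproduces `f` and
  -- hence `Re f`.
  have hpois : ∀ v ∈ ball (0 : ℂ) R, (g v).re = (f v).re := by
    intro v hv
    have hk : ContinuousOn (re ∘ herglotzRieszKernel 0 v) (sphere 0 R) := by
      have := continuousOn_herglotzRieszKernel_sphere (c := 0) hv
      rw [abs_of_pos hR] at this
      exact continuous_re.comp_continuousOn this
    have hint : CircleIntegrable ((re ∘ herglotzRieszKernel 0 v) • f) 0 R :=
      (hk.smul hcont).circleIntegrable hR.le
    rw [hg, re_circleAverage_herglotzRieszKernel_smul hre hv]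
    conv_rhs => rw [← hf.circleAverage_re_herglotzRieszKernel_smul hv]
    rw [← reCLM_apply (Real.circleAverage _ _ _), ← reCLM.circleAverage_comp_comm hint]
    congr 1
    ext ζ
    simp
  have hsub : AnalyticOnNhd ℂ (fun v ↦ f v - g v) (ball 0 R) :=
    (hf.differentiableOn.sub hdiff).analyticOnNhd isOpen_ball
  have hgz : (g 0).im = 0 := by
    have h1 : g 0 = ((Real.circleAverage (fun ζ ↦ (f ζ).re) 0 R : ℝ) : ℂ) := by
      rw [← ofRealCLM_apply (Real.circleAverage _ _ _), ← ofRealCLM.circleAverage_comp_comm hre]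
      refine Real.circleAverage_congr_sphere fun ζ hζ ↦ ?_
      have : ζ ≠ 0 := by
        rintro rfl
        simp [eq_comm] at hζ; exact hR.ne' hζ
      simp [herglotzRieszKernel_def, div_self this]
    rw [h1, ofReal_im]
  -- `f - g` is analytic with vanishing real part, hence constant; the constant is read off at the
  -- centre, where both functions are real.
  obtain ⟨c, hc⟩ := hsub.eq_const_of_re_eq_const (c₀ := 0)
    (fun v hv ↦ by simp [hpois v hv]) isOpen_ball
    ⟨⟨0, mem_ball_self hR⟩, (convex_ball (0 : ℂ) R).isPreconnected⟩
  have hc0 : c = 0 := by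
    rw [← hc 0 (mem_ball_self hR)]
    apply Complex.ext <;> simp [hpois 0 (mem_ball_self hR), h0, hgz]
  exact sub_eq_zero.mp ((hc w hw).trans hc0)

/-- The dilate `w ↦ f (r w)` is continuous up to the circle, so its boundary values supply the
density `Re f(r e^{iθ}) / 2π`. -/
theorem exists_probabilityMeasure_circle_of_lt_one {f : ℂ → ℂ}
    (hf : DifferentiableOn ℂ f (ball 0 1)) (h0 : f 0 = 1) (hpos : ∀ w ∈ ball (0 : ℂ) 1, 0 ≤ (f w).re)
    {r : ℝ} (hr : r ∈ Set.Ioo 0 1) :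
    ∃ σ : ProbabilityMeasure (sphere (0 : ℂ) 1), ∀ w ∈ ball (0 : ℂ) 1,
      f (r * w) = ∫ ζ : sphere (0 : ℂ) 1, ((ζ : ℂ) + w) / (ζ - w) ∂(σ : Measure (sphere (0 : ℂ) 1)) := by
  obtain ⟨hr0, hr1⟩ := hr
  have hmem : ∀ v ∈ closedBall (0 : ℂ) 1, (r : ℂ) * v ∈ ball (0 : ℂ) 1 := by
    intro v hv
    rw [mem_closedBall_zero_iff] at hv
    rw [mem_ball_zero_iff, norm_mul, norm_real, Real.norm_of_nonneg hr0.le]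
    nlinarith [norm_nonneg v]
  have hg : DiffContOnCl ℂ (fun v ↦ f (r * v)) (ball 0 1) := by
    refine DifferentiableOn.diffContOnCl ?_
    rw [closure_ball _ one_ne_zero]
    exact hf.comp (by fun_prop) hmem
  have hgz : f (r * 0) = 1 := by rw [mul_zero, h0]
  have hsch := fun w hw ↦ herglotz_eq_circleAverage_re hg (by rw [hgz, one_im]) (w := w) hw
  let p : ℝ → sphere (0 : ℂ) 1 := fun θ ↦ ⟨circleMap 0 1 θ, by simp⟩
  have hp : Measurable p := (measurable_circleMap 0 1).subtype_mk
  let d : ℝ → ℝ := fun θ ↦ (2 * Real.pi)⁻¹ * (f (r * circleMap 0 1 θ)).re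
  have hd : Continuous d := by
    have h1 : ContinuousOn (fun v ↦ f (r * v)) (closedBall 0 1) := by
      have := hg.continuousOn
      rwa [closure_ball _ one_ne_zero] at this
    have h2 : Continuous fun θ ↦ f (r * circleMap 0 1 θ) :=
      h1.comp_continuous (continuous_circleMap 0 1) fun θ ↦ by simp
    exact continuous_const.mul (continuous_re.comp h2)
  have hd0 (θ : ℝ) : 0 ≤ d θ :=
    mul_nonneg (by positivity) (hpos _ (hmem _ (by simp)))
  let m : Measure ℝ := (volume.restrict (Set.Ioc 0 (2 * Real.pi))).withDensity
    fun θ ↦ ENNReal.ofReal (d θ)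
  have hdm : Measurable fun θ ↦ ENNReal.ofReal (d θ) := hd.measurable.ennreal_ofReal
  have key (w : ℂ) (hw : w ∈ ball (0 : ℂ) 1) :
      f (r * w) = ∫ ζ : sphere (0 : ℂ) 1, ((ζ : ℂ) + w) / (ζ - w) ∂(m.map p) := by
    rw [hsch w hw, integral_map hp.aemeasurable
      (Measurable.aestronglyMeasurable (by fun_prop)),
      integral_withDensity_eq_integral_toReal_smul hdm (by simp), Real.circleAverage_def,
      intervalIntegral.integral_of_le Real.two_pi_pos.le, ← integral_smul]
    refine integral_congr_ae (Filter.Eventually.of_forall fun θ ↦ ?_)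
    simp only [ENNReal.toReal_ofReal (hd0 θ), herglotzRieszKernel_def, sub_zero, d, p,
      real_smul, smul_eq_mul, ofReal_mul]
    ring
  have hprob : IsProbabilityMeasure (m.map p) := by
    have hfin : IsFiniteMeasure m := by
      refine isFiniteMeasure_withDensity_ofReal ?_
      exact (hd.integrableOn_Ioc).2
    have : IsFiniteMeasure (m.map p) := inferInstance
    -- At `w = 0` the kernel is `1`, so the total mass equals `f 0 = 1`.
    have h1 := key 0 (mem_ball_self one_pos)
    have h2 : ∫ ζ : sphere (0 : ℂ) 1, ((ζ : ℂ) + 0) / (ζ - 0) ∂(m.map p) =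
        ((m.map p).real Set.univ : ℂ) := by
      rw [integral_congr_ae (g := fun _ ↦ (1 : ℂ)) (Filter.Eventually.of_forall fun ζ ↦ ?_)]
      · simp
      · have : (ζ : ℂ) ≠ 0 := ne_zero_of_mem_unit_sphere ζ
        simp [div_self this]
    rw [h2, hgz] at h1
    have h3 : (m.map p).real Set.univ = 1 := by exact_mod_cast h1.symm
    exact ⟨by rw [← ENNReal.ofReal_toReal (measure_ne_top (m.map p) Set.univ)]
              change ENNReal.ofReal ((m.map p).real Set.univ) = 1
              rw [h3, ENNReal.ofReal_one]⟩
  exact ⟨⟨m.map p, hprob⟩, key⟩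

/-- The measures belonging to `r < 1` lie in a weakly compact space. An ultrafilter finer than `r →
1⁻` picks a limit, and for fixed `w` the kernel is a continuous test function on the circle. -/
theorem exists_probabilityMeasure_circle {f : ℂ → ℂ}
    (hf : DifferentiableOn ℂ f (ball 0 1)) (h0 : f 0 = 1)
    (hpos : ∀ w ∈ ball (0 : ℂ) 1, 0 ≤ (f w).re) :
    ∃ σ : ProbabilityMeasure (sphere (0 : ℂ) 1), ∀ w ∈ ball (0 : ℂ) 1,
      f w = ∫ ζ : sphere (0 : ℂ) 1, ((ζ : ℂ) + w) / (ζ - w) ∂(σ : Measure (sphere (0 : ℂ) 1)) := by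
  have : Nonempty (ProbabilityMeasure (sphere (0 : ℂ) 1)) :=
    ⟨(exists_probabilityMeasure_circle_of_lt_one hf h0 hpos (r := 1 / 2) (by norm_num)).choose⟩
  choose! σ hσ using fun r hr ↦ exists_probabilityMeasure_circle_of_lt_one hf h0 hpos (r := r) hr
  let u : Ultrafilter ℝ := Ultrafilter.of (𝓝[<] 1)
  have hu : (u : Filter ℝ) ≤ 𝓝[<] 1 := Ultrafilter.of_le _
  obtain ⟨s, -, hs⟩ := isCompact_univ.ultrafilter_le_nhds (u.map σ) (by simp)
  have hs' : Tendsto σ u (𝓝 s) := hs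
  refine ⟨s, fun w hw ↦ ?_⟩
  have hne (ζ : sphere (0 : ℂ) 1) : (ζ : ℂ) - w ≠ 0 := by
    intro h
    rw [sub_eq_zero] at h
    rw [← h] at hw
    simp at hw
  let k : BoundedContinuousFunction (sphere (0 : ℂ) 1) ℂ := BoundedContinuousFunction.mkOfCompact
    ⟨fun ζ ↦ ((ζ : ℂ) + w) / (ζ - w), by fun_prop (disch := exact hne)⟩
  have h1 := (ProbabilityMeasure.tendsto_iff_forall_integral_rclike_tendsto ℂ).1 hs' k
  have h2 : Tendsto (fun r : ℝ ↦ f (r * w)) u (𝓝 (f w)) := by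
    have hc : ContinuousAt f w := (hf.differentiableAt (isOpen_ball.mem_nhds hw)).continuousAt
    have h3 : Tendsto (fun r : ℝ ↦ (r : ℂ) * w) (𝓝 1) (𝓝 w) := by
      have : Continuous fun r : ℝ ↦ (r : ℂ) * w := by fun_prop
      simpa using this.tendsto 1
    exact hc.tendsto.comp (h3.mono_left (hu.trans nhdsWithin_le_nhds))
  have h4 : ∀ᶠ r in (u : Filter ℝ), r ∈ Set.Ioo (0 : ℝ) 1 :=
    hu (Ioo_mem_nhdsLT zero_lt_one)
  refine tendsto_nhds_unique (h2.congr' ?_) h1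
  filter_upwards [h4] with r hr
  exact hσ r hr w hw
end Disc

/-! ### The Herglotz representation in the upper half-plane -/

/-- The transform `∫ (1 + t z) / (t - z) dρ(t)` of a measure on the real line. -/
noncomputable def nevanlinnaTransform (ρ : Measure ℝ) (z : ℂ) : ℂ :=
  ∫ t : ℝ, (1 + (t : ℂ) * z) / ((t : ℂ) - z) ∂ρ

section HalfPlane

open Complex Metric Filter Topology

theorem ofReal_sub_ne_zero {z : ℂ} (hz : 0 < z.im) (t : ℝ) : (t : ℂ) - z ≠ 0 := by
  intro h
  have := congrArg im h
  simp at this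
  exact hz.ne' this

/-- The disc theorem applies to `-i W` composed with the Cayley map `w ↦ i (1 + w) / (1 - w)`. The
point `ζ = 1` of the circle goes to infinity, so its mass becomes `b`; the rest of the measure is
pushed to the line. No additive constant occurs since `Re W(i) = 0`. -/
theorem exists_nevanlinna_representation {W : ℂ → ℂ} (hW : DifferentiableOn ℂ W {z | 0 < z.im})
    (hpos : ∀ z : ℂ, 0 < z.im → 0 < (W z).im) (hI : W I = I) :
    ∃ (b : ℝ) (ρ : Measure ℝ), 0 ≤ b ∧ IsFiniteMeasure ρ ∧ b + ρ.real Set.univ = 1 ∧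
      ∀ z : ℂ, 0 < z.im → W z = b * z + nevanlinnaTransform ρ z := by
  have hcay : ∀ w ∈ ball (0 : ℂ) 1, 0 < (I * (1 + w) / (1 - w)).im := by
    intro w hw
    have h1 : 0 < 1 - normSq w := by
      rw [mem_ball_zero_iff] at hw
      rw [normSq_eq_norm_sq]
      nlinarith [norm_nonneg w]
    have h2 : 1 - w ≠ 0 := by
      intro h
      rw [← sub_eq_zero.mp h] at h1
      simp at h1
    have h3 : (I * (1 + w) / (1 - w)).im = (1 - normSq w) / normSq (1 - w) := by
      rw [div_im]
      have h4 : normSq (1 - w) ≠ 0 := by simpa using h2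
      field_simp
      simp [normSq_apply]
      ring
    rw [h3]
    exact div_pos h1 (normSq_pos.mpr h2)
  have hne1 : ∀ w ∈ ball (0 : ℂ) 1, 1 - w ≠ 0 := by
    rintro w hw h
    rw [← sub_eq_zero.mp h] at hw
    simp at hw
  obtain ⟨σ, hσ⟩ := exists_probabilityMeasure_circle
    (f := fun w ↦ -I * W (I * (1 + w) / (1 - w)))
    (by
      refine (differentiableOn_const _).mul (hW.comp ?_ hcay)
      exact (by fun_prop : DifferentiableOn ℂ (fun w : ℂ ↦ I * (1 + w)) _).div (by fun_prop) hne1)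
    (by simp [hI]) (fun w hw ↦ by simpa using (hpos _ (hcay w hw)).le)
  let e : sphere (0 : ℂ) 1 := ⟨1, by simp⟩
  -- The Cayley map is real on the circle. At `ζ = 1` division by zero gives `0`, which is harmless
  -- because that point is removed before the pushforward.
  let q : sphere (0 : ℂ) 1 → ℝ := fun ζ ↦ (I * (1 + ζ) / (1 - ζ)).re
  have hq : Measurable q := by fun_prop
  have hqv (ζ : sphere (0 : ℂ) 1) : (q ζ : ℂ) = I * (1 + ζ) / (1 - ζ) := by
    apply Complex.ext
    · simp [q]
    · have h1 : normSq (ζ : ℂ) = 1 := by simp [normSq_eq_norm_sq]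
      rw [normSq_apply] at h1
      rw [ofReal_im, div_im]
      simp only [mul_im, mul_re, I_re, I_im, add_re, add_im, sub_re, sub_im, one_re, one_im]
      rw [← sub_div]
      symm
      apply div_eq_zero_iff.mpr
      left
      linear_combination - h1
  refine ⟨(σ : Measure (sphere (0 : ℂ) 1)).real {e},
    ((σ : Measure (sphere (0 : ℂ) 1)).restrict {e}ᶜ).map q, measureReal_nonneg, inferInstance, ?_, ?_⟩
  · rw [map_measureReal_apply hq MeasurableSet.univ, Set.preimage_univ, measureReal_restrict_apply_univ]
    rw [measureReal_add_measureReal_compl (measurableSet_singleton e)]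
    simp
  · intro z hz
    have hzi : z + I ≠ 0 := by
      intro h
      have := congrArg im h
      simp at this
      linarith
    set w := (z - I) / (z + I) with hw
    have hwb : w ∈ ball (0 : ℂ) 1 := by
      rw [mem_ball_zero_iff, hw, norm_div, div_lt_one (norm_pos_iff.mpr hzi)]
      rw [← sq_lt_sq₀ (norm_nonneg _) (norm_nonneg _), ← normSq_eq_norm_sq, ← normSq_eq_norm_sq]
      simp [normSq_apply]
      nlinarith
    have hw1 : 1 - w = 2 * I / (z + I) := by rw [hw]; field_simp; ring
    have hw2 : 1 + w = 2 * z / (z + I) := by rw [hw]; field_simp; ring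
    have hwz : I * (1 + w) / (1 - w) = z := by
      rw [hw1, hw2]
      field_simp
    have h1 := hσ w hwb
    simp only [hwz] at h1
    have hne (ζ : sphere (0 : ℂ) 1) : (ζ : ℂ) - w ≠ 0 := by
      intro h
      rw [← sub_eq_zero.mp h] at hwb
      simp at hwb
    have hint : Integrable (fun ζ : sphere (0 : ℂ) 1 ↦ I * (((ζ : ℂ) + w) / (ζ - w)))
        (σ : Measure (sphere (0 : ℂ) 1)) := by
      have hc : Continuous (fun ζ : sphere (0 : ℂ) 1 ↦ I * (((ζ : ℂ) + w) / (ζ - w))) := by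
        fun_prop (disch := exact hne)
      exact (BoundedContinuousFunction.mkOfCompact ⟨_, hc⟩).integrable _
    have h2 : W z = ∫ ζ : sphere (0 : ℂ) 1, I * (((ζ : ℂ) + w) / (ζ - w))
        ∂(σ : Measure (sphere (0 : ℂ) 1)) := by
      rw [integral_const_mul, ← h1, ← mul_assoc]
      simp
    rw [h2, ← integral_add_compl (measurableSet_singleton e) hint, nevanlinnaTransform,
      integral_map hq.aemeasurable (Measurable.aestronglyMeasurable (by fun_prop))]
    congr 1
    · rw [integral_singleton]
      simp only [e, real_smul]
      rw [← hwz]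
      ring
    · refine setIntegral_congr_fun (measurableSet_singleton e).compl fun ζ hζ ↦ ?_
      have hζ1 : 1 - (ζ : ℂ) ≠ 0 := by
        intro h
        exact hζ (Subtype.ext (sub_eq_zero.mp h).symm)
      have h3 := ofReal_sub_ne_zero hz (q ζ)
      have h4 : (ζ : ℂ) - (z - I) / (z + I) ≠ 0 := hne ζ
      rw [hqv] at h3 ⊢
      rw [eq_div_iff h3, hw]
      have h5 : (ζ : ℂ) * (z + I) - (z - I) ≠ 0 := by
        intro h
        apply h4
        field_simp
        linear_combination h
      field_simp
      linear_combination (I * ((ζ : ℂ) ^ 2 - 1) + z * (ζ : ℂ) ^ 2 + z - 2 * ζ * z) * I_sq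

end HalfPlane

/-! ### Behaviour of the transform along the imaginary axis. -/

section Asymptotics

open Complex Filter Topology

theorem norm_sq_ofReal_sub_I_mul (t y : ℝ) : ‖(t : ℂ) - I * y‖ ^ 2 = t ^ 2 + y ^ 2 := by
  rw [← normSq_eq_norm_sq]
  simp [normSq_apply]
  ring

theorem norm_sq_one_add_ofReal_mul (t y : ℝ) : ‖1 + (t : ℂ) * (I * y)‖ ^ 2 = 1 + t ^ 2 * y ^ 2 := by
  rw [← normSq_eq_norm_sq]
  simp [normSq_apply]
  ring

theorem norm_nevanlinna_kernel_le {t y C : ℝ} (hy : 0 < y) (hC : 0 ≤ C)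
    (h : 1 + t ^ 2 * y ^ 2 ≤ C ^ 2 * (t ^ 2 + y ^ 2)) :
    ‖(1 + (t : ℂ) * (I * y)) / ((t : ℂ) - I * y)‖ ≤ C := by
  have h0 : 0 < ‖(t : ℂ) - I * y‖ := norm_pos_iff.mpr (ofReal_sub_ne_zero (by simpa using hy) t)
  rw [norm_div, div_le_iff₀ h0, ← sq_le_sq₀ (norm_nonneg _) (by positivity), mul_pow,
    norm_sq_ofReal_sub_I_mul, norm_sq_one_add_ofReal_mul]
  exact h

theorem measurable_nevanlinna_kernel (z : ℂ) :
    Measurable fun t : ℝ ↦ (1 + (t : ℂ) * z) / ((t : ℂ) - z) := by fun_prop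

theorem integrable_nevanlinna_kernel (ρ : Measure ℝ) [IsFiniteMeasure ρ] {y : ℝ} (hy : 0 < y) :
    Integrable (fun t : ℝ ↦ (1 + (t : ℂ) * (I * y)) / ((t : ℂ) - I * y)) ρ := by
  refine Integrable.of_bound (measurable_nevanlinna_kernel _).aestronglyMeasurable (y + 1 / y)
    (Eventually.of_forall fun t ↦ norm_nevanlinna_kernel_le hy (by positivity) ?_)
  have : (y + 1 / y) ^ 2 = y ^ 2 + 2 + (1 / y) ^ 2 := by field_simp; ring
  have h2 : (1 / y) ^ 2 * y ^ 2 = 1 := by field_simp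
  rw [this]
  nlinarith [sq_nonneg t, sq_nonneg y, sq_nonneg (1 / y * t), sq_nonneg (y * y)]

/-- Dominated convergence: for `y ≥ 1` the kernel at `i y` is bounded by `y`, and for fixed `t` also
by `1 + |t|`. -/
theorem tendsto_nevanlinnaTransform_div (ρ : Measure ℝ) [IsFiniteMeasure ρ] :
    Tendsto (fun y : ℝ ↦ nevanlinnaTransform ρ (I * y) / y) atTop (𝓝 0) := by
  have h0 : (0 : ℂ) = ∫ _ : ℝ, (0 : ℂ) ∂ρ := by simp
  rw [h0]
  simp only [nevanlinnaTransform, ← integral_div]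
  refine tendsto_integral_filter_of_dominated_convergence (fun _ ↦ 1)
    (Eventually.of_forall fun y ↦ ((measurable_nevanlinna_kernel _).div_const _).aestronglyMeasurable)
    ?_ (integrable_const _) (Eventually.of_forall fun t ↦ ?_)
  · filter_upwards [eventually_ge_atTop 1] with y hy
    refine Eventually.of_forall fun t ↦ ?_
    have hy0 : 0 < y := by linarith
    rw [norm_div, norm_real, Real.norm_of_nonneg hy0.le, div_le_one hy0]
    refine norm_nevanlinna_kernel_le hy0 hy0.le ?_
    nlinarith [one_le_pow₀ (n := 4) hy]
  · refine squeeze_zero_norm' (a := fun y ↦ (1 + |t|) / y) ?_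
      (tendsto_const_nhds.div_atTop tendsto_id)
    filter_upwards [eventually_ge_atTop 1] with y hy
    have hy0 : 0 < y := by linarith
    rw [norm_div, norm_real, Real.norm_of_nonneg hy0.le]
    gcongr
    refine norm_nevanlinna_kernel_le hy0 (by positivity) ?_
    have h1 : 1 + t ^ 2 ≤ (1 + |t|) ^ 2 := by nlinarith [sq_abs t, abs_nonneg t]
    have h2 : (1 + t ^ 2) * (t ^ 2 + y ^ 2) ≤ (1 + |t|) ^ 2 * (t ^ 2 + y ^ 2) := by gcongr
    nlinarith [sq_nonneg (t ^ 2), sq_nonneg t]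

theorem im_nevanlinna_kernel {y : ℝ} (hy : 0 < y) (t : ℝ) :
    ((1 + (t : ℂ) * (I * y)) / ((t : ℂ) - I * y)).im = y * (1 + t ^ 2) / (t ^ 2 + y ^ 2) := by
  have h : 0 < t ^ 2 + y ^ 2 := by positivity
  rw [div_im, normSq_eq_norm_sq, norm_sq_ofReal_sub_I_mul]
  simp
  field_simp
  ring

/-- Fatou's lemma along `y = n`: `y` times the imaginary part of the kernel is `(1 + t²) y² / (t² +
y²)`, which tends to `1 + t²`. -/
theorem lintegral_lt_top_of_eventually_le (ρ : Measure ℝ) [IsFiniteMeasure ρ] {C : ℝ}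
    (h : ∀ᶠ y : ℝ in atTop, y * (nevanlinnaTransform ρ (I * y)).im ≤ C) :
    ∫⁻ t : ℝ, ENNReal.ofReal (1 + t ^ 2) ∂ρ < ⊤ := by
  let g : ℕ → ℝ → ENNReal := fun n t ↦
    ENNReal.ofReal (n * ((1 + (t : ℂ) * (I * (n : ℝ))) / ((t : ℂ) - I * (n : ℝ))).im)
  have hg : ∀ n, Measurable (g n) := fun n ↦ by
    exact ((measurable_im.comp (measurable_nevanlinna_kernel _)).const_mul _).ennreal_ofReal
  have hlim (t : ℝ) : Tendsto (fun n ↦ g n t) atTop (𝓝 (ENNReal.ofReal (1 + t ^ 2))) := by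
    refine ENNReal.tendsto_ofReal ?_
    have h1 : Tendsto (fun n : ℕ ↦ (1 + t ^ 2) / (t ^ 2 / (n : ℝ) ^ 2 + 1)) atTop
        (𝓝 ((1 + t ^ 2) / (0 + 1))) := by
      refine tendsto_const_nhds.div (Tendsto.add_const _ (tendsto_const_nhds.div_atTop ?_))
        (by norm_num)
      exact (tendsto_pow_atTop two_ne_zero).comp tendsto_natCast_atTop_atTop
    rw [zero_add, div_one] at h1
    refine h1.congr' ?_
    filter_upwards [eventually_gt_atTop 0] with n hn
    have hn0 : (0 : ℝ) < n := by exact_mod_cast hn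
    rw [im_nevanlinna_kernel hn0]
    field_simp
  have hle : ∀ᶠ n : ℕ in atTop, ∫⁻ t, g n t ∂ρ ≤ ENNReal.ofReal C := by
    filter_upwards [tendsto_natCast_atTop_atTop.eventually h, eventually_gt_atTop 0] with n hn hn1
    have hn0 : (0 : ℝ) < n := by exact_mod_cast hn1
    have hint := integrable_nevanlinna_kernel ρ hn0
    have hint' : Integrable (fun t : ℝ ↦
        (n : ℝ) * ((1 + (t : ℂ) * (I * (n : ℝ))) / ((t : ℂ) - I * (n : ℝ))).im) ρ :=
      hint.im.const_mul _
    change ∫⁻ t : ℝ, ENNReal.ofReal _ ∂ρ ≤ _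
    rw [← ofReal_integral_eq_lintegral_ofReal hint' ?_]
    · refine ENNReal.ofReal_le_ofReal ?_
      rw [integral_const_mul]
      refine le_trans (le_of_eq ?_) hn
      congr 1
      exact integral_im hint
    · refine Eventually.of_forall fun t ↦ ?_
      change 0 ≤ (n : ℝ) * ((1 + (t : ℂ) * (I * (n : ℝ))) / ((t : ℂ) - I * (n : ℝ))).im
      rw [im_nevanlinna_kernel hn0]
      positivity
  calc ∫⁻ t : ℝ, ENNReal.ofReal (1 + t ^ 2) ∂ρ
      = ∫⁻ t : ℝ, liminf (fun n ↦ g n t) atTop ∂ρ := by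
        simp only [(hlim _).liminf_eq]
    _ ≤ liminf (fun n ↦ ∫⁻ t, g n t ∂ρ) atTop := lintegral_liminf_le hg
    _ ≤ ENNReal.ofReal C := liminf_le_of_frequently_le' hle.frequently
    _ < ⊤ := ENNReal.ofReal_lt_top

/-- The kernel at `i y` equals `-t + (1 + t²) / (t - i y)`, and `y / (t - i y)` tends to `i` with
modulus at most `1`. Hence `c = -∫ t dρ` and `m = ∫ (1 + t²) dρ`. -/
theorem exists_nevanlinnaTransform_asymptotics (ρ : Measure ℝ) [IsFiniteMeasure ρ]
    (h : ∫⁻ t : ℝ, ENNReal.ofReal (1 + t ^ 2) ∂ρ < ⊤) :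
    ∃ c m : ℝ, ρ.real Set.univ ≤ m ∧
      Tendsto (fun y : ℝ ↦ nevanlinnaTransform ρ (I * y)) atTop (𝓝 c) ∧
      Tendsto (fun y : ℝ ↦ y * (nevanlinnaTransform ρ (I * y) - c)) atTop (𝓝 (I * m)) := by
  have hi : Integrable (fun t : ℝ ↦ 1 + t ^ 2) ρ := by
    refine ⟨by fun_prop, ?_⟩
    rw [hasFiniteIntegral_iff_ofReal (Eventually.of_forall fun t ↦ by positivity)]
    exact h
  have hi1 : Integrable (fun t : ℝ ↦ t) ρ := by
    refine hi.mono' (by fun_prop) (Eventually.of_forall fun t ↦ ?_)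
    rw [Real.norm_eq_abs]
    nlinarith [sq_abs t, sq_nonneg (|t| - 1)]
  have hi2 : Integrable (fun t : ℝ ↦ (t : ℂ)) ρ := hi1.ofReal
  have key : Tendsto (fun y : ℝ ↦ y * (nevanlinnaTransform ρ (I * y) - (-∫ t, t ∂ρ : ℝ))) atTop
      (𝓝 (I * (∫ t, (1 + t ^ 2) ∂ρ : ℝ))) := by
    have h1 : ∀ᶠ y : ℝ in atTop, ∫ t : ℝ, (y / (t - I * y) * ((1 + t ^ 2 : ℝ) : ℂ)) ∂ρ =
        y * (nevanlinnaTransform ρ (I * y) - (-∫ t, t ∂ρ : ℝ)) := by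
      filter_upwards [eventually_gt_atTop 0] with y hy
      rw [ofReal_neg, sub_neg_eq_add, ← integral_complex_ofReal, nevanlinnaTransform,
        ← integral_add (integrable_nevanlinna_kernel ρ hy) hi2, ← integral_const_mul]
      refine integral_congr_ae (Eventually.of_forall fun t ↦ ?_)
      have := ofReal_sub_ne_zero (z := I * y) (by simpa using hy) t
      have hk : (1 + (t : ℂ) * (I * y)) / (t - I * y) + t = (1 + t ^ 2) / (t - I * y) := by
        rw [div_add' _ _ _ this]
        ring
      beta_reduce
      rw [hk]
      push_cast
      ring
    refine Tendsto.congr' h1 ?_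
    rw [← integral_complex_ofReal, ← integral_const_mul]
    refine tendsto_integral_filter_of_dominated_convergence (fun t ↦ 1 + t ^ 2)
      (Eventually.of_forall fun y ↦ Measurable.aestronglyMeasurable (by fun_prop))
      ?_ hi (Eventually.of_forall fun t ↦ ?_)
    · filter_upwards [eventually_gt_atTop 0] with y hy
      refine Eventually.of_forall fun t ↦ ?_
      have h0 : 0 < ‖(t : ℂ) - I * y‖ :=
        norm_pos_iff.mpr (ofReal_sub_ne_zero (by simpa using hy) t)
      rw [norm_mul, norm_real, Real.norm_of_nonneg (by positivity), norm_div, norm_real,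
        Real.norm_of_nonneg hy.le]
      refine mul_le_of_le_one_left (by positivity) ?_
      rw [div_le_one h0, ← sq_le_sq₀ hy.le h0.le, norm_sq_ofReal_sub_I_mul]
      nlinarith
    · refine Tendsto.mul_const _ ?_
      have h2 : Tendsto (fun y : ℝ ↦ 1 / ((t : ℂ) * ((y⁻¹ : ℝ) : ℂ) - I)) atTop
          (𝓝 (1 / ((t : ℂ) * ((0 : ℝ) : ℂ) - I))) := by
        refine tendsto_const_nhds.div (Tendsto.sub_const (Tendsto.const_mul _ ?_) _) (by simp)
        exact (continuous_ofReal.tendsto 0).comp tendsto_inv_atTop_zero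
      have h3 : 1 / ((t : ℂ) * ((0 : ℝ) : ℂ) - I) = I := by simp
      rw [h3] at h2
      refine h2.congr' ?_
      filter_upwards [eventually_gt_atTop 0] with y hy
      have := ofReal_sub_ne_zero (z := I * y) (by simpa using hy) t
      have hy0 : (y : ℂ) ≠ 0 := by exact_mod_cast hy.ne'
      push_cast
      have h5 : (t : ℂ) * (y : ℂ)⁻¹ - I = (t - I * y) / y := by field_simp
      rw [h5, one_div_div]
  refine ⟨-∫ t, t ∂ρ, ∫ t, (1 + t ^ 2) ∂ρ, ?_, ?_, key⟩
  · have : ρ.real Set.univ = ∫ _ : ℝ, (1 : ℝ) ∂ρ := by simp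
    rw [this]
    exact integral_mono (integrable_const _) hi fun t ↦ by simp [sq_nonneg]
  · have h4 := ((continuous_ofReal.tendsto 0).comp tendsto_inv_atTop_zero).mul key
    rw [ofReal_zero, zero_mul] at h4
    rw [← tendsto_sub_nhds_zero_iff]
    refine h4.congr' ?_
    filter_upwards [eventually_gt_atTop 0] with y hy
    have hy0 : (y : ℂ) ≠ 0 := by exact_mod_cast hy.ne'
    simp only [Function.comp, ofReal_inv]
    rw [inv_mul_cancel_left₀ hy0]

end Asymptotics

/-! ### Möbius transformations of the Donoghue class -/

section Donoghue

open Complex Filter Topology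

/-- The measure is `dρ = dμ / (1 + t²)`, from `1 / (t - z) - t / (1 + t²) = (1 + t z) / ((t - z) (1
+ t²))`. -/
theorem IsDonoghue.exists_nevanlinnaTransform {f : ℂ → ℂ} (hf : IsDonoghue f) :
    ∃ ρ : Measure ℝ, IsProbabilityMeasure ρ ∧ ∫⁻ t : ℝ, ENNReal.ofReal (1 + t ^ 2) ∂ρ = ⊤ ∧
      ∀ z : ℂ, 0 < z.im → f z = nevanlinnaTransform ρ z := by
  obtain ⟨-, -, μ, hμ, h1, hrep⟩ := hf
  have hm : Measurable fun t : ℝ ↦ ENNReal.ofReal (1 / (1 + t ^ 2)) := by fun_prop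
  refine ⟨μ.withDensity fun t ↦ ENNReal.ofReal (1 / (1 + t ^ 2)), ⟨?_⟩, ?_, fun z hz ↦ ?_⟩
  · rw [withDensity_apply _ MeasurableSet.univ, Measure.restrict_univ, h1]
  · rw [lintegral_withDensity_eq_lintegral_mul _ hm (by fun_prop), ← hμ, ← lintegral_one]
    refine lintegral_congr fun t ↦ ?_
    have : 0 < 1 + t ^ 2 := by positivity
    rw [Pi.mul_apply, ← ENNReal.ofReal_mul (by positivity), one_div_mul_cancel this.ne',
      ENNReal.ofReal_one]
  · rw [hrep z hz, nevanlinnaTransform,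
      integral_withDensity_eq_integral_toReal_smul hm (by simp)]
    refine integral_congr_ae (Eventually.of_forall fun t ↦ ?_)
    have h2 : (1 + (t : ℂ) ^ 2) ≠ 0 := by
      have : 1 + t ^ 2 ≠ 0 := by positivity
      exact_mod_cast this
    have h3 := ofReal_sub_ne_zero hz t
    simp only
    rw [ENNReal.toReal_ofReal (by positivity), real_smul]
    push_cast
    field_simp
    ring

theorem isDonoghue_of_nevanlinnaTransform {f : ℂ → ℂ} (hd : DifferentiableOn ℂ f {z | 0 < z.im})
    (hpos : ∀ z : ℂ, 0 < z.im → 0 < (f z).im) {ρ : Measure ℝ} [IsProbabilityMeasure ρ]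
    (hρ : ∫⁻ t : ℝ, ENNReal.ofReal (1 + t ^ 2) ∂ρ = ⊤)
    (hrep : ∀ z : ℂ, 0 < z.im → f z = nevanlinnaTransform ρ z) : IsDonoghue f := by
  have hm : Measurable fun t : ℝ ↦ ENNReal.ofReal (1 + t ^ 2) := by fun_prop
  refine ⟨hd, hpos, ρ.withDensity fun t ↦ ENNReal.ofReal (1 + t ^ 2), ?_, ?_, fun z hz ↦ ?_⟩
  · rw [withDensity_apply _ MeasurableSet.univ, Measure.restrict_univ, hρ]
  · rw [lintegral_withDensity_eq_lintegral_mul _ hm (by fun_prop),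
      ← measure_univ (μ := ρ), ← lintegral_one]
    refine lintegral_congr fun t ↦ ?_
    have : 0 < 1 + t ^ 2 := by positivity
    rw [Pi.mul_apply, ← ENNReal.ofReal_mul (by positivity), mul_one_div_cancel this.ne',
      ENNReal.ofReal_one]
  · rw [hrep z hz, nevanlinnaTransform,
      integral_withDensity_eq_integral_toReal_smul hm (by simp)]
    refine integral_congr_ae (Eventually.of_forall fun t ↦ ?_)
    have h2 : (1 + (t : ℂ) ^ 2) ≠ 0 := by
      have : 1 + t ^ 2 ≠ 0 := by positivity
      exact_mod_cast this
    have h3 := ofReal_sub_ne_zero hz t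
    simp only
    rw [ENNReal.toReal_ofReal (by positivity), real_smul]
    push_cast
    field_simp
    ring

theorem IsDonoghue.congr {f g : ℂ → ℂ} (hf : IsDonoghue f)
    (h : ∀ z : ℂ, 0 < z.im → g z = f z) : IsDonoghue g := by
  obtain ⟨hd, hpos, μ, hμ, h1, hrep⟩ := hf
  exact ⟨hd.congr h, fun z hz ↦ h z hz ▸ hpos z hz, μ, hμ, h1,
    fun z hz ↦ (h z hz).trans (hrep z hz)⟩

theorem nevanlinnaTransform_I (ρ : Measure ℝ) [IsProbabilityMeasure ρ] :
    nevanlinnaTransform ρ I = I := by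
  have h : ∀ t : ℝ, (1 + (t : ℂ) * I) / (t - I) = I := by
    intro t
    rw [div_eq_iff (ofReal_sub_ne_zero (by simp) t)]
    linear_combination I_sq
  simp [nevanlinnaTransform, h]

theorem im_div_sub_ofReal (t : ℝ) {v : ℂ} (hv : (t : ℂ) - v ≠ 0) :
    ((t * v + 1) / (t - v)).im = (1 + t ^ 2) * v.im / ‖(t : ℂ) - v‖ ^ 2 := by
  have h : ‖(t : ℂ) - v‖ ^ 2 ≠ 0 := by simpa using hv
  rw [div_im, normSq_eq_norm_sq]
  field_simp
  simp
  ring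

theorem IsDonoghue.moebius {f : ℂ → ℂ} (hf : IsDonoghue f) (t : ℝ) :
    IsDonoghue fun z ↦ (t * f z + 1) / (t - f z) := by
  obtain ⟨σ, hσ, hσtop, hfσ⟩ := hf.exists_nevanlinnaTransform
  obtain ⟨hd, hpos, -⟩ := hf
  set W : ℂ → ℂ := fun z ↦ (t * f z + 1) / (t - f z) with hW
  have hne (z : ℂ) (hz : 0 < z.im) : (t : ℂ) - f z ≠ 0 := ofReal_sub_ne_zero (hpos z hz) t
  have hWd : DifferentiableOn ℂ W {z | 0 < z.im} :=
    ((hd.const_mul _).add_const _).div (hd.const_sub _) hne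
  have hWpos (z : ℂ) (hz : 0 < z.im) : 0 < (W z).im := by
    rw [hW, im_div_sub_ofReal t (hne z hz)]
    have := hpos z hz
    have := norm_pos_iff.mpr (hne z hz)
    positivity
  have hWI : W I = I := by
    have h1 : f I = I := by rw [hfσ I (by simp), nevanlinnaTransform_I]
    rw [hW]
    simp only [h1]
    rw [div_eq_iff (ofReal_sub_ne_zero (by simp) t)]
    linear_combination I_sq
  obtain ⟨b, ρ, hb, hρ, hmass, hrep⟩ := exists_nevanlinna_representation hWd hWpos hWI
  have hIy {y : ℝ} (hy : 0 < y) : 0 < (I * y).im := by simpa using hy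
  have hWt (z : ℂ) (hz : 0 < z.im) : W z + t ≠ 0 := by
    intro h
    have := congrArg im h
    simp at this
    exact (hWpos z hz).ne' this
  have hfW (z : ℂ) (hz : 0 < z.im) : f z = (t * W z - 1) / (W z + t) := by
    rw [eq_div_iff (hWt z hz), hW]
    have := hne z hz
    field_simp
    ring
  have him (z : ℂ) (hz : 0 < z.im) : (f z).im = (1 + t ^ 2) * (W z).im / ‖W z + t‖ ^ 2 := by
    have h1 : ((-t : ℝ) : ℂ) - W z ≠ 0 := ofReal_sub_ne_zero (hWpos z hz) _
    have h2 := im_div_sub_ofReal (-t) h1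
    have h3 : (((-t : ℝ) : ℂ) * W z + 1) / (((-t : ℝ) : ℂ) - W z) = f z := by
      rw [hfW z hz, div_eq_div_iff h1 (hWt z hz)]
      push_cast
      ring
    rw [h3] at h2
    rw [h2, neg_sq]
    congr 2
    rw [← norm_neg]
    push_cast
    congr 1
    ring
  -- A finite limit would make `∫ (1 + t²) dσ` finite, against `μ(ℝ) = ∞`.
  have hnolim (L : ℝ) : ¬ Tendsto (fun y : ℝ ↦ y * (f (I * y)).im) atTop (𝓝 L) := by
    intro hL
    refine (lintegral_lt_top_of_eventually_le σ (C := L + 1) ?_).ne hσtop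
    filter_upwards [hL.eventually_le_const (lt_add_one L), eventually_gt_atTop 0] with y hy hy0
    rwa [← hfσ _ (hIy hy0)]
  have hf0 : Tendsto (fun y : ℝ ↦ f (I * y) / y) atTop (𝓝 0) := by
    refine (tendsto_nevanlinnaTransform_div σ).congr' ?_
    filter_upwards [eventually_gt_atTop 0] with y hy
    rw [hfσ _ (hIy hy)]
  -- If `b ≠ 0`, then `W(iy) / y → i b`, and `him` gives `y Im f(iy) → (1 + t²) / b`.
  have hb0 : b = 0 := by
    by_contra hb1
    have hWy : Tendsto (fun y : ℝ ↦ W (I * y) / y) atTop (𝓝 (b * I)) := by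
      have h1 := (tendsto_nevanlinnaTransform_div ρ).const_add ((b : ℂ) * I)
      rw [add_zero] at h1
      refine h1.congr' ?_
      filter_upwards [eventually_gt_atTop 0] with y hy
      have hy0 : (y : ℂ) ≠ 0 := by exact_mod_cast hy.ne'
      rw [hrep _ (hIy hy)]
      field_simp
    have ht : Tendsto (fun y : ℝ ↦ (t : ℂ) / y) atTop (𝓝 0) := by
      have h1 : Tendsto (fun y : ℝ ↦ t / y) atTop (𝓝 0) :=
        tendsto_const_nhds.div_atTop tendsto_id
      have h2 := (continuous_ofReal.tendsto 0).comp h1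
      simpa [Function.comp_def] using h2
    have h1 := (continuous_im.tendsto _).comp hWy
    have h2 := ((hWy.add ht).norm.pow 2)
    have h3 := (h1.const_mul (1 + t ^ 2)).div h2 (by simpa using hb1)
    refine hnolim _ (h3.congr' ?_)
    filter_upwards [eventually_gt_atTop 0] with y hy
    have hy0 : (y : ℂ) ≠ 0 := by exact_mod_cast hy.ne'
    have h4 := norm_pos_iff.mpr (hWt _ (hIy hy))
    simp only [Pi.div_apply, Function.comp]
    rw [him _ (hIy hy), ← add_div, norm_div, norm_real, Real.norm_of_nonneg hy.le, div_ofReal_im]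
    field_simp
  rw [hb0, zero_add] at hmass
  simp only [hb0, ofReal_zero, zero_mul, zero_add] at hrep
  have hprob : IsProbabilityMeasure ρ := by
    refine ⟨?_⟩
    rw [← ENNReal.ofReal_toReal (measure_ne_top ρ Set.univ)]
    change ENNReal.ofReal (ρ.real Set.univ) = 1
    rw [hmass, ENNReal.ofReal_one]
  refine isDonoghue_of_nevanlinnaTransform hWd hWpos ?_ hrep
  by_contra htop
  obtain ⟨c, m, hm, hc, hcm⟩ := exists_nevanlinnaTransform_asymptotics ρ (lt_top_iff_ne_top.mpr htop)
  rw [hmass] at hm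
  have hev : ∀ᶠ y : ℝ in atTop, nevanlinnaTransform ρ (I * y) = W (I * y) := by
    filter_upwards [eventually_gt_atTop 0] with y hy
    rw [hrep _ (hIy hy)]
  replace hc : Tendsto (fun y : ℝ ↦ W (I * y)) atTop (𝓝 c) := hc.congr' hev
  replace hcm : Tendsto (fun y : ℝ ↦ y * (W (I * y) - c)) atTop (𝓝 (I * m)) := by
    refine hcm.congr' ?_
    filter_upwards [hev] with y hy
    rw [hy]
  -- The limit `c` of `W(iy)` may be the pole `-t` of the inverse map. Then `f(iy) / y` tends to
  -- `-(1 + t²) / (i m) ≠ 0`. Otherwise `y Im f(iy)` tends to `(1 + t²) m / (c + t)²`. Both are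
  -- excluded.
  by_cases hct : (c : ℂ) + t = 0
  · have h1 := ((hc.const_mul (t : ℂ)).sub_const 1).div hcm
      (mul_ne_zero I_ne_zero (by exact_mod_cast (by linarith : m ≠ 0)))
    have h2 : Tendsto (fun y : ℝ ↦ f (I * y) / y) atTop (𝓝 ((t * c - 1) / (I * m))) := by
      refine h1.congr' ?_
      filter_upwards [eventually_gt_atTop 0] with y hy
      have hy0 : (y : ℂ) ≠ 0 := by exact_mod_cast hy.ne'
      have h3 := hWt _ (hIy hy)
      have h4 : W (I * y) - c = W (I * y) + t := by linear_combination - hct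
      simp only [Pi.div_apply]
      rw [hfW _ (hIy hy), h4]
      field_simp
    have h3 := tendsto_nhds_unique h2 hf0
    rw [div_eq_zero_iff] at h3
    rcases h3 with h3 | h3
    · have h4 : t * c - 1 = 0 := by exact_mod_cast h3
      have h5 : c + t = 0 := by exact_mod_cast hct
      obtain rfl : c = -t := by linarith
      nlinarith [sq_nonneg t]
    · exact mul_ne_zero I_ne_zero (by exact_mod_cast (by linarith : m ≠ 0)) h3
  · have h1 := (continuous_im.tendsto _).comp hcm
    have h2 := ((hc.add_const (t : ℂ)).norm.pow 2)
    have h3 := (h1.const_mul (1 + t ^ 2)).div h2 (by simpa using hct)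
    refine hnolim _ (h3.congr' ?_)
    filter_upwards [eventually_gt_atTop 0] with y hy
    have h4 := norm_pos_iff.mpr (hWt _ (hIy hy))
    simp only [Pi.div_apply, Function.comp]
    rw [him _ (hIy hy), im_ofReal_mul, sub_im, ofReal_im, sub_zero]
    field_simp

end Donoghue

/-! ### The impedance function of a coupling -/

section RiggedImpedance

open Complex

theorem sumMinus_injective (V X : Type*) [NormedAddCommGroup V] [InnerProductSpace ℂ V]
    [NormedAddCommGroup X] [InnerProductSpace ℂ X] : Function.Injective (sumMinus V X) := by
  rintro ⟨a, b⟩ ⟨a', b'⟩ h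
  have h1 (f : V) (y : X) : a f + inner ℂ y b = a' f + inner ℂ y b' := by
    have := DFunLike.congr_fun h (WithLp.toLp 2 (f, y))
    rwa [sumMinus_apply, sumMinus_apply] at this
  refine Prod.ext ?_ (ext_inner_left ℂ fun y ↦ by simpa using h1 0 y)
  ext f
  simpa using h1 f 0

theorem chanAdjoint_eq_conj {V : Type*} [NormedAddCommGroup V] [InnerProductSpace ℂ V]
    (K : ℂ →L[ℂ] AntiDual V) (f : V) : chanAdjoint K f = (starRingEnd ℂ) (K 1 f) := by
  have h := inner_chanAdjoint K f 1
  simp at h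
  rw [← h, conj_conj]

theorem ContinuousLinearMap.apply_eq_smul_apply_one {W : Type*} [NormedAddCommGroup W]
    [NormedSpace ℂ W] (K : ℂ →L[ℂ] W) (c : ℂ) : K c = c • K 1 := by
  rw [← map_smul, smul_eq_mul, mul_one]

namespace RiggedArray

variable {V H : Type*} [NormedAddCommGroup V] [InnerProductSpace ℂ V]
  [NormedAddCommGroup H] [InnerProductSpace ℂ H]

theorem rePencil_injective {S : RiggedArray V H ℂ} {z : ℂ} (hz : z ∈ S.reResolventSet) {x y : V}
    (h : S.rePencil z x = S.rePencil z y) : x = y := by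
  obtain ⟨w, -, hw⟩ := hz.1 0
  have h1 : S.rePencil z (x - y) = toMinus S.emb 0 := by simp [h]
  have h2 : S.rePencil z 0 = toMinus S.emb 0 := by simp
  exact sub_eq_zero.mp ((hw _ h1).trans (hw _ h2).symm)

theorem scalarImpedance_eq {S : RiggedArray V H ℂ} {z : ℂ} (hz : S.ImpedanceDefinedAt z) {x : V}
    (hx : S.rePencil z x = S.K 1) : S.scalarImpedance z = chanAdjoint S.K x := by
  rw [scalarImpedance, impedance, dif_pos hz]
  congr 1
  exact rePencil_injective hz.1 ((hz.2 1).choose_spec.trans hx.symm)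

/-- `K*` is continuous only for the norm of `V`, whereas the resolvent set asks for bounds in `H`.
Since `K 1 = (Re M - z) ξ` and `Re M` is symmetric, `K* x` is expressed through `H`-inner products
of `ξ` with `h` and with `x`, both controlled by `‖h‖`. -/
theorem exists_norm_chanAdjoint_le {S : RiggedArray V H ℂ} {z : ℂ} (hF : S.F = 1)
    (hz : S.ImpedanceDefinedAt z) :
    ∃ D : ℝ, ∀ (x : V) (h : H), S.rePencil z x = toMinus S.emb h →
      ‖chanAdjoint S.K x‖ ≤ D * ‖h‖ := by
  obtain ⟨ξ, hξ⟩ := hz.2 1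
  obtain ⟨C, hC⟩ := hz.1.2
  refine ⟨(1 + ‖(starRingEnd ℂ) z - z‖ * C) * ‖S.emb ξ‖, fun x h hx ↦ ?_⟩
  have h1 := DFunLike.congr_fun hξ x
  have h2 := DFunLike.congr_fun hx ξ
  have h3 : biRe S.M ξ x = (starRingEnd ℂ) (biRe S.M x ξ) := by
    simp [biRe, add_comm, map_ofNat (starRingEnd ℂ) 2]
  simp only [rePencil, hF, sub_apply, smul_apply, ContinuousLinearMap.comp_apply,
    toMinus_apply, one_apply_eq_self, smul_eq_mul] at h1 h2
  have h4 : S.K 1 x = inner ℂ h (S.emb ξ) +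
      ((starRingEnd ℂ) z - z) * inner ℂ (S.emb x) (S.emb ξ) := by
    rw [← h1, h3, ← sub_add_cancel (biRe S.M x ξ) (z * inner ℂ (S.emb ξ) (S.emb x)), h2]
    simp only [map_add, map_mul, inner_conj_symm]
    ring
  rw [chanAdjoint_eq_conj, RCLike.norm_conj, h4]
  calc _ ≤ ‖inner ℂ h (S.emb ξ)‖ + ‖((starRingEnd ℂ) z - z) * inner ℂ (S.emb x) (S.emb ξ)‖ :=
        norm_add_le _ _
    _ ≤ ‖h‖ * ‖S.emb ξ‖ + ‖(starRingEnd ℂ) z - z‖ * (C * ‖h‖ * ‖S.emb ξ‖) := by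
        rw [norm_mul]
        gcongr
        · exact norm_inner_le_norm _ _
        · exact (norm_inner_le_norm _ _).trans (by gcongr; exact hC x h hx)
    _ = _ := by ring

end RiggedArray

/-- The real part `(M + M*) / 2` of the main operator of an F-system. -/
noncomputable def FSystem.reM {E : Type*} [NormedAddCommGroup E] [InnerProductSpace ℂ E] [CompleteSpace E]
    {J : E →L[ℂ] E} (Φ : FSystem E J) : Φ.X →L[ℂ] Φ.X :=
  (1 / 2 : ℂ) • (Φ.M + Φ.M.adjoint)

theorem conj_adjoint_apply {X : Type*} [NormedAddCommGroup X] [InnerProductSpace ℂ X]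
    [CompleteSpace X] (K : ℂ →L[ℂ] X) (f : X) :
    (starRingEnd ℂ) (K.adjoint f) = inner ℂ f (K 1) := by
  rw [← ContinuousLinearMap.adjoint_inner_left]
  simp

namespace RiggedArray

variable {V H : Type*} [NormedAddCommGroup V] [InnerProductSpace ℂ V]
  [NormedAddCommGroup H] [InnerProductSpace ℂ H]

/-- The single corner `2i K₁ K₂*` of the coupling splits in the real part into `i K₁ K₂*` above and
`-i K₂ K₁*` below the diagonal. -/
theorem couple_rePencil (S : RiggedArray V H ℂ) (Φ : FSystem ℂ (1 : ℂ →L[ℂ] ℂ)) (hΦ : Φ.F = 0)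
    (z : ℂ) (p : WithLp 2 (V × Φ.X)) :
    (S.couple Φ).rePencil z p = sumMinus V Φ.X
      (S.rePencil z p.fst + (I * Φ.K.adjoint p.snd) • S.K 1,
        Φ.reM p.snd - (I * chanAdjoint S.K p.fst) • Φ.K 1) := by
  ext f
  rw [sumMinus_apply]
  simp only [rePencil, couple, biRe, sub_apply, smul_apply, add_apply, biAdjoint_apply,
    ContinuousLinearMap.comp_apply, sumMinus_apply, blockUpper_apply, toMinus_apply, smul_eq_mul,
    one_apply_eq_self, hΦ, zero_apply, add_zero,
    WithLp.prod_inner_apply, WithLp.ofLp_fst, WithLp.ofLp_snd, toLpSum_fst, toLpSum_snd,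
    FSystem.reM, inner_sub_right, inner_smul_right, inner_add_right, inner_zero_right,
    map_add, map_mul, ContinuousLinearMap.adjoint_inner_right, inner_conj_symm,
    chanAdjoint_eq_conj]
  rw [ContinuousLinearMap.apply_eq_smul_apply_one S.K (Φ.K.adjoint p.snd),
    ContinuousLinearMap.apply_eq_smul_apply_one S.K (Φ.K.adjoint f.snd)]
  simp only [smul_apply, smul_eq_mul, map_mul, conj_adjoint_apply, conj_I, map_ofNat]
  ring

theorem couple_toMinus (S : RiggedArray V H ℂ) (Φ : FSystem ℂ (1 : ℂ →L[ℂ] ℂ))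
    (h : WithLp 2 (H × Φ.X)) :
    toMinus (S.couple Φ).emb h = sumMinus V Φ.X (toMinus S.emb h.fst, h.snd) := by
  ext f
  simp [sumMinus_apply, couple, blockUpper_apply, toLpSum_fst, toLpSum_snd,
    WithLp.prod_inner_apply]

theorem couple_chanAdjoint (S : RiggedArray V H ℂ) (Φ : FSystem ℂ (1 : ℂ →L[ℂ] ℂ))
    (p : WithLp 2 (V × Φ.X)) :
    chanAdjoint (S.couple Φ).K p = chanAdjoint S.K p.fst + Φ.K.adjoint p.snd := by
  rw [chanAdjoint_eq_conj, chanAdjoint_eq_conj, ← conj_conj (Φ.K.adjoint p.snd),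
    conj_adjoint_apply, ← map_add]
  rfl

end RiggedArray

end RiggedImpedance

/-! ### Schur complement formula and real parts of the controllers. -/

section CouplingImpedance

open Complex

namespace RiggedArray

variable {V H : Type*} [NormedAddCommGroup V] [InnerProductSpace ℂ V]
  [NormedAddCommGroup H] [InnerProductSpace ℂ H]

-- Block elimination, with `L` the inverse of the Schur complement `Re M - v K₂ K₂*`: `hR` yields
-- solutions, `hL` uniqueness.
set_option maxHeartbeats 1000000 in
theorem couple_impedance {S : RiggedArray V H ℂ} {Φ : FSystem ℂ (1 : ℂ →L[ℂ] ℂ)} {z : ℂ}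
    (hF : S.F = 1) (hΦ : Φ.F = 0) (hz : S.ImpedanceDefinedAt z) (L : Φ.X →L[ℂ] Φ.X)
    (hL : ∀ y, L (Φ.reM y - (S.scalarImpedance z * Φ.K.adjoint y) • Φ.K 1) = y)
    (hR : ∀ y, Φ.reM (L y) - (S.scalarImpedance z * Φ.K.adjoint (L y)) • Φ.K 1 = y) :
    (S.couple Φ).ImpedanceDefinedAt z ∧ (S.couple Φ).scalarImpedance z =
      S.scalarImpedance z + (1 + S.scalarImpedance z ^ 2) * Φ.K.adjoint (L (Φ.K 1)) := by
  obtain ⟨ξ, hξ⟩ := hz.2 1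
  obtain ⟨C, hC⟩ := hz.1.2
  obtain ⟨D, hD⟩ := exists_norm_chanAdjoint_le hF hz
  have hv := scalarImpedance_eq hz hξ
  set v := S.scalarImpedance z with hvdef
  let Y : V → Φ.X → Φ.X := fun x₀ h ↦ L (h + (I * chanAdjoint S.K x₀) • Φ.K 1)
  -- The solution for the right-hand side `((Re 𝔸 - z) x₀, h)`; parametrizing by `x₀` serves both
  -- right-hand sides in `H` and the channel vector `K₁ 1`, where `x₀ = ξ`.
  let sol : V → Φ.X → WithLp 2 (V × Φ.X) := fun x₀ h ↦
    WithLp.toLp 2 (x₀ - (I * Φ.K.adjoint (Y x₀ h)) • ξ, Y x₀ h)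
  have hfst (x₀ : V) (h : Φ.X) : (sol x₀ h).fst = x₀ - (I * Φ.K.adjoint (Y x₀ h)) • ξ := rfl
  have hsnd (x₀ : V) (h : Φ.X) : (sol x₀ h).snd = Y x₀ h := rfl
  have hsol (x₀ : V) (h : Φ.X) :
      (S.couple Φ).rePencil z (sol x₀ h) = sumMinus V Φ.X (S.rePencil z x₀, h) := by
    rw [couple_rePencil S Φ hΦ]
    congr 1
    refine Prod.ext ?_ ?_
    · simp [sol, hξ]
    · have h1 := hR (h + (I * chanAdjoint S.K x₀) • Φ.K 1)
      rw [← sub_eq_iff_eq_add] at h1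
      have h2 : I * chanAdjoint S.K (x₀ - (I * Φ.K.adjoint (Y x₀ h)) • ξ) =
          v * Φ.K.adjoint (Y x₀ h) + I * chanAdjoint S.K x₀ := by
        rw [map_sub, map_smul, ← hv, smul_eq_mul]
        linear_combination (- v * Φ.K.adjoint (Y x₀ h)) * I_sq
      simp only [hfst, hsnd]
      rw [h2, add_smul, ← sub_sub]
      exact h1
  have hinj : Function.Injective ((S.couple Φ).rePencil z) := by
    rw [injective_iff_map_eq_zero]
    intro p hp
    rw [couple_rePencil S Φ hΦ, map_eq_zero_iff _ (sumMinus_injective V Φ.X), Prod.mk_eq_zero] at hp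
    obtain ⟨h1, h2⟩ := hp
    have h3 : p.fst = -(I * Φ.K.adjoint p.snd) • ξ := by
      refine rePencil_injective hz.1 ?_
      rw [map_smul, hξ, neg_smul (I * Φ.K.adjoint p.snd) (S.K 1)]
      exact eq_neg_of_add_eq_zero_left h1
    have h4 : p.snd = 0 := by
      rw [← hL p.snd, ← map_zero L]
      congr 1
      rw [← h2, h3, map_smul, ← hv, smul_eq_mul]
      congr 2
      linear_combination v * Φ.K.adjoint p.snd * I_sq
    have h5 : p.fst = 0 := by rw [h3, h4]; simp
    exact (WithLp.ofLp_injective 2) (Prod.ext h5 h4)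
  have hres : z ∈ (S.couple Φ).reResolventSet := by
    refine ⟨fun h ↦ ?_, ?_⟩
    · obtain ⟨x₀, hx₀, -⟩ := hz.1.1 h.fst
      have h1 : (S.couple Φ).rePencil z (sol x₀ h.snd) = toMinus (S.couple Φ).emb h := by
        rw [hsol, couple_toMinus]
        exact congrArg (fun g ↦ sumMinus V Φ.X (g, h.snd)) hx₀
      exact ⟨_, h1, fun x hx ↦ hinj (hx.trans h1.symm)⟩
    · refine ⟨|C| + ‖L‖ * (1 + |D| * ‖Φ.K 1‖) * (‖Φ.K.adjoint‖ * ‖S.emb ξ‖ + 1), fun x h hx ↦ ?_⟩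
      obtain ⟨x₀, hx₀, -⟩ := hz.1.1 h.fst
      have h1 : (S.couple Φ).rePencil z (sol x₀ h.snd) = toMinus (S.couple Φ).emb h := by
        rw [hsol, couple_toMinus]
        exact congrArg (fun g ↦ sumMinus V Φ.X (g, h.snd)) hx₀
      obtain rfl := hinj (hx.trans h1.symm)
      have hnf : ‖h.fst‖ ≤ ‖h‖ := WithLp.norm_fst_le _ h
      have hns : ‖h.snd‖ ≤ ‖h‖ := WithLp.norm_snd_le _ h
      have hY : ‖Y x₀ h.snd‖ ≤ ‖L‖ * (1 + |D| * ‖Φ.K 1‖) * ‖h‖ := by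
        refine (L.le_opNorm _).trans ?_
        rw [mul_assoc]
        gcongr
        refine (norm_add_le _ _).trans ?_
        rw [norm_smul, norm_mul, norm_I, one_mul]
        have h2 : ‖chanAdjoint S.K x₀‖ ≤ |D| * ‖h‖ :=
          (hD _ _ hx₀).trans (by gcongr; exact le_abs_self D)
        nlinarith [mul_le_mul_of_nonneg_right h2 (norm_nonneg (Φ.K 1))]
      have hC0 : ‖S.emb x₀‖ ≤ |C| * ‖h‖ :=
        (hC _ _ hx₀).trans (mul_le_mul (le_abs_self C) hnf (norm_nonneg _) (abs_nonneg C))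
      have hef : ((S.couple Φ).emb (sol x₀ h.snd)).fst =
          S.emb x₀ - (I * Φ.K.adjoint (Y x₀ h.snd)) • S.emb ξ := by
        simp [couple, blockUpper_apply, toLpSum_fst, hfst]
      have hes : ((S.couple Φ).emb (sol x₀ h.snd)).snd = Y x₀ h.snd := by
        simp [couple, blockUpper_apply, toLpSum_snd, hsnd]
      have hKY : ‖(I * Φ.K.adjoint (Y x₀ h.snd)) • S.emb ξ‖ ≤
          ‖Φ.K.adjoint‖ * ‖Y x₀ h.snd‖ * ‖S.emb ξ‖ := by
        rw [norm_smul, norm_mul, norm_I, one_mul]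
        gcongr
        exact ContinuousLinearMap.le_opNorm _ _
      calc ‖(S.couple Φ).emb (sol x₀ h.snd)‖
          ≤ ‖S.emb x₀ - (I * Φ.K.adjoint (Y x₀ h.snd)) • S.emb ξ‖ + ‖Y x₀ h.snd‖ := by
            rw [WithLp.prod_norm_eq_of_L2, hef, hes]
            refine Real.sqrt_le_iff.mpr ⟨by positivity, ?_⟩
            nlinarith [norm_nonneg (S.emb x₀ - (I * Φ.K.adjoint (Y x₀ h.snd)) • S.emb ξ),
              norm_nonneg (Y x₀ h.snd)]
        _ ≤ |C| * ‖h‖ + ‖Φ.K.adjoint‖ * ‖Y x₀ h.snd‖ * ‖S.emb ξ‖ + ‖Y x₀ h.snd‖ := by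
            gcongr
            exact (norm_sub_le _ _).trans (add_le_add hC0 hKY)
        _ = |C| * ‖h‖ + ‖Y x₀ h.snd‖ * (‖Φ.K.adjoint‖ * ‖S.emb ξ‖ + 1) := by ring
        _ ≤ |C| * ‖h‖ + ‖L‖ * (1 + |D| * ‖Φ.K 1‖) * ‖h‖ * (‖Φ.K.adjoint‖ * ‖S.emb ξ‖ + 1) := by
            gcongr
        _ = _ := by ring
  refine ⟨⟨hres, fun e ↦ ?_⟩, ?_⟩
  · obtain ⟨x₀, hx₀⟩ := hz.2 e
    exact ⟨sol x₀ (Φ.K e), by rw [hsol, hx₀]; rfl⟩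
  · have hdef : (S.couple Φ).ImpedanceDefinedAt z := ⟨hres, fun e ↦ by
      obtain ⟨x₀, hx₀⟩ := hz.2 e
      exact ⟨sol x₀ (Φ.K e), by rw [hsol, hx₀]; rfl⟩⟩
    have h1 : (S.couple Φ).rePencil z (sol ξ (Φ.K 1)) = (S.couple Φ).K 1 := by
      rw [hsol, hξ]; rfl
    rw [scalarImpedance_eq hdef h1, couple_chanAdjoint]
    -- The first component contributes another factor `1 - i v`, and `(1 + i v) (1 - i v) = 1 + v²`.
    have hY : Y ξ (Φ.K 1) = (1 + I * v) • L (Φ.K 1) := by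
      simp only [Y, ← hv, map_add, map_smul, add_smul, one_smul]
    simp only [hfst, hsnd, hY, map_sub, map_smul, smul_eq_mul, ← hv]
    linear_combination (- v ^ 2 * Φ.K.adjoint (L (Φ.K 1))) * I_sq

end RiggedArray

theorem basicController_F (t : ℝ) : (basicController t).F = 0 := rfl

theorem FSystem.mul_F {Φ₁ Φ₂ : FSystem ℂ (1 : ℂ →L[ℂ] ℂ)} (h₁ : Φ₁.F = 0) (h₂ : Φ₂.F = 0) :
    (Φ₁.mul Φ₂).F = 0 := by
  have h : blockUpper Φ₁.F 0 Φ₂.F = 0 := by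
    ext1 x
    simp [blockUpper_apply, h₁, h₂]
  change (toLpSum Φ₁.X Φ₂.X).comp (blockUpper Φ₁.F 0 Φ₂.F) = 0
  rw [h, ContinuousLinearMap.comp_zero]

theorem FSystem.mul_K_adjoint {Φ₁ Φ₂ : FSystem ℂ (1 : ℂ →L[ℂ] ℂ)} (p : WithLp 2 (Φ₁.X × Φ₂.X)) :
    (Φ₁.mul Φ₂).K.adjoint p = Φ₁.K.adjoint p.fst + Φ₂.K.adjoint p.snd :=
  adjoint_toLpSum_prod _ _ _

theorem FSystem.inner_reM (Φ : FSystem ℂ (1 : ℂ →L[ℂ] ℂ)) (f p : Φ.X) :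
    inner ℂ f (Φ.reM p) = (1 / 2) * (inner ℂ f (Φ.M p) + (starRingEnd ℂ) (inner ℂ p (Φ.M f))) := by
  rw [FSystem.reM, smul_apply, add_apply, inner_smul_right, inner_add_right,
    ContinuousLinearMap.adjoint_inner_right, inner_conj_symm]

theorem FSystem.inner_mul_M {Φ₁ Φ₂ : FSystem ℂ (1 : ℂ →L[ℂ] ℂ)} (f p : WithLp 2 (Φ₁.X × Φ₂.X)) :
    inner ℂ f ((Φ₁.mul Φ₂).M p) = inner ℂ f.fst (Φ₁.M p.fst) +
      2 * I * Φ₂.K.adjoint p.snd * inner ℂ f.fst (Φ₁.K 1) + inner ℂ f.snd (Φ₂.M p.snd) := by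
  change inner ℂ f (toLpSum Φ₁.X Φ₂.X (blockUpper _ _ _ p)) = _
  rw [WithLp.prod_inner_apply, blockUpper_apply]
  simp only [WithLp.ofLp_fst, WithLp.ofLp_snd, toLpSum_fst, toLpSum_snd, inner_add_right,
    smul_apply, ContinuousLinearMap.comp_apply, one_apply_eq_self, inner_smul_right]
  rw [ContinuousLinearMap.apply_eq_smul_apply_one Φ₁.K (Φ₂.K.adjoint p.snd), inner_smul_right]
  ring

theorem FSystem.mul_reM {Φ₁ Φ₂ : FSystem ℂ (1 : ℂ →L[ℂ] ℂ)} (p : WithLp 2 (Φ₁.X × Φ₂.X)) :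
    (Φ₁.mul Φ₂).reM p = toLpSum Φ₁.X Φ₂.X
      (Φ₁.reM p.fst + (I * Φ₂.K.adjoint p.snd) • Φ₁.K 1,
        Φ₂.reM p.snd - (I * Φ₁.K.adjoint p.fst) • Φ₂.K 1) := by
  refine ext_inner_left (E := WithLp 2 (Φ₁.X × Φ₂.X)) ℂ fun f ↦ ?_
  refine (FSystem.inner_reM (Φ₁.mul Φ₂) f p).trans ?_
  refine (congrArg₂ (fun a b ↦ (1 / 2) * (a + (starRingEnd ℂ) b))
    (FSystem.inner_mul_M f p) (FSystem.inner_mul_M p f)).trans ?_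
  rw [WithLp.prod_inner_apply]
  simp only [WithLp.ofLp_fst, WithLp.ofLp_snd, toLpSum_fst, toLpSum_snd, inner_add_right,
    inner_sub_right, inner_smul_right, FSystem.inner_reM, map_add, map_mul, conj_adjoint_apply,
    conj_I, map_ofNat]
  rw [← conj_adjoint_apply Φ₁.K, ← conj_adjoint_apply Φ₁.K, conj_conj]
  ring

theorem basicController_K_adjoint (t : ℝ) (y : ℂ) : (basicController t).K.adjoint y = y :=
  DFunLike.congr_fun (star_one (ℂ →L[ℂ] ℂ)) y

theorem basicController_reM (t : ℝ) (y : ℂ) : (basicController t).reM y = (t : ℂ) * y := by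
  have h1 : (basicController t).M = (((t : ℂ) + I) • (1 : ℂ →L[ℂ] ℂ) : ℂ →L[ℂ] ℂ) := rfl
  have h2 : ContinuousLinearMap.adjoint (1 : ℂ →L[ℂ] ℂ) = 1 := star_one _
  change ((1 / 2 : ℂ) • ((((t : ℂ) + I) • (1 : ℂ →L[ℂ] ℂ)) +
    ContinuousLinearMap.adjoint (((t : ℂ) + I) • (1 : ℂ →L[ℂ] ℂ))) : ℂ →L[ℂ] ℂ) y = _
  rw [map_smulₛₗ, h2]
  simp
  ring

end CouplingImpedance

/-! ### Impedance of the coupling with one or two basic controllers. -/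

section Controllers

open Complex

variable {V H : Type*} [NormedAddCommGroup V] [InnerProductSpace ℂ V]
  [NormedAddCommGroup H] [InnerProductSpace ℂ H]

theorem RiggedArray.couple_basicController_impedance {S : RiggedArray V H ℂ} {z : ℂ} (hF : S.F = 1)
    (hz : S.ImpedanceDefinedAt z) {t : ℝ} (ht : (t : ℂ) - S.scalarImpedance z ≠ 0) :
    (S.couple (basicController t)).ImpedanceDefinedAt z ∧
      (S.couple (basicController t)).scalarImpedance z =
        (t * S.scalarImpedance z + 1) / (t - S.scalarImpedance z) := by
  set v := S.scalarImpedance z with hv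
  let L : ℂ →L[ℂ] ℂ := ((t : ℂ) - v)⁻¹ • 1
  have hB (y : ℂ) : (basicController t).reM y -
      (v * (basicController t).K.adjoint y) • (basicController t).K 1 = ((t : ℂ) - v) * y := by
    rw [basicController_reM, basicController_K_adjoint]
    change (t : ℂ) * y - (v * y) * 1 = _
    ring
  have hLy (y : ℂ) : L y = ((t : ℂ) - v)⁻¹ * y := by simp [L]
  obtain ⟨h1, h2⟩ := RiggedArray.couple_impedance (Φ := basicController t) hF
    (basicController_F t) hz L
    (fun (y : ℂ) ↦ (congrArg L (hB y)).trans (by rw [hLy, inv_mul_cancel_left₀ ht]))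
    (fun (y : ℂ) ↦ (hB (L y)).trans (by rw [hLy, mul_inv_cancel_left₀ ht]))
  refine ⟨h1, h2.trans ?_⟩
  have h3 : (basicController t).K.adjoint (L ((basicController t).K 1)) = ((t : ℂ) - v)⁻¹ := by
    refine (basicController_K_adjoint t _).trans ((hLy 1).trans (mul_one _))
  refine (congrArg (fun w ↦ v + (1 + v ^ 2) * w) h3).trans ?_
  field_simp
  ring

theorem RiggedArray.couple_basicController_mul_impedance {S : RiggedArray V H ℂ} {z : ℂ}
    (hF : S.F = 1) (hz : S.ImpedanceDefinedAt z) {s t : ℝ}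
    (hD : (s * t - 1 : ℂ) - (s + t) * S.scalarImpedance z ≠ 0) :
    (S.couple ((basicController s).mul (basicController t))).ImpedanceDefinedAt z ∧
      (S.couple ((basicController s).mul (basicController t))).scalarImpedance z =
        S.scalarImpedance z + (1 + S.scalarImpedance z ^ 2) *
          ((s + t) / ((s * t - 1) - (s + t) * S.scalarImpedance z)) := by
  set v := S.scalarImpedance z with hv
  set D : ℂ := (s * t - 1) - (s + t) * v with hDdef
  set Φ := (basicController s).mul (basicController t) with hΦ
  -- The Schur complement has rows `(s - v, i - v)` and `(-(i + v), t - v)`; its determinant is `D`,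
  -- and `L` is the adjugate over `D`. The entries of the adjugate add up to `s + t`.
  let L : WithLp 2 (ℂ × ℂ) →L[ℂ] WithLp 2 (ℂ × ℂ) := (toLpSum ℂ ℂ).comp
    ((D⁻¹ • ((t - v) • WithLp.fstL 2 ℂ ℂ ℂ - (I - v) • WithLp.sndL 2 ℂ ℂ ℂ)).prod
      (D⁻¹ • ((I + v) • WithLp.fstL 2 ℂ ℂ ℂ + (s - v) • WithLp.sndL 2 ℂ ℂ ℂ)))
  have hL (p : WithLp 2 (ℂ × ℂ)) : L p = toLpSum ℂ ℂ
      (D⁻¹ * ((t - v) * p.fst - (I - v) * p.snd), D⁻¹ * ((I + v) * p.fst + (s - v) * p.snd)) := rfl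
  have hB (p : WithLp 2 (ℂ × ℂ)) : Φ.reM p - (v * Φ.K.adjoint p) • Φ.K 1 = toLpSum ℂ ℂ
      ((s - v) * p.fst + (I - v) * p.snd, -(I + v) * p.fst + (t - v) * p.snd) := by
    refine (congrArg₂ (fun (a : Φ.X) (b : ℂ) ↦ a - (v * b) • Φ.K 1)
      (FSystem.mul_reM (Φ₁ := basicController s) (Φ₂ := basicController t) p)
      (FSystem.mul_K_adjoint (Φ₁ := basicController s) (Φ₂ := basicController t) p)).trans ?_
    refine (WithLp.ofLp_injective 2) (Prod.ext ?_ ?_)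
    · change (fun a b c : ℂ ↦ (a + (I * b) * 1) - (v * (c + b)) * 1) ((basicController s).reM p.fst)
        ((basicController t).K.adjoint p.snd) ((basicController s).K.adjoint p.fst) =
          ((s : ℂ) - v) * p.fst + (I - v) * p.snd
      rw [basicController_reM, basicController_K_adjoint, basicController_K_adjoint]
      ring
    · change (fun a b c : ℂ ↦ (a - (I * c) * 1) - (v * (c + b)) * 1) ((basicController t).reM p.snd)
        ((basicController t).K.adjoint p.snd) ((basicController s).K.adjoint p.fst) =
          -(I + v) * p.fst + ((t : ℂ) - v) * p.snd
      rw [basicController_reM, basicController_K_adjoint, basicController_K_adjoint]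
      ring
  obtain ⟨h1, h2⟩ := RiggedArray.couple_impedance (Φ := Φ) hF
    (FSystem.mul_F (basicController_F s) (basicController_F t)) hz L
    (fun (p : WithLp 2 (ℂ × ℂ)) ↦ (congrArg L (hB p)).trans (by
      rw [hL]
      refine (WithLp.ofLp_injective 2) (Prod.ext ?_ ?_)
      · change D⁻¹ * ((t - v) * ((s - v) * p.fst + (I - v) * p.snd) -
          (I - v) * (-(I + v) * p.fst + (t - v) * p.snd)) = p.fst
        rw [inv_mul_eq_iff_eq_mul₀ hD, hDdef]
        linear_combination p.fst * I_sq
      · change D⁻¹ * ((I + v) * ((s - v) * p.fst + (I - v) * p.snd) +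
          (s - v) * (-(I + v) * p.fst + (t - v) * p.snd)) = p.snd
        rw [inv_mul_eq_iff_eq_mul₀ hD, hDdef]
        linear_combination p.snd * I_sq))
    (fun (p : WithLp 2 (ℂ × ℂ)) ↦ (hB (L p)).trans (by
      rw [hL]
      refine (WithLp.ofLp_injective 2) (Prod.ext ?_ ?_)
      · change (s - v) * (D⁻¹ * ((t - v) * p.fst - (I - v) * p.snd)) +
          (I - v) * (D⁻¹ * ((I + v) * p.fst + (s - v) * p.snd)) = p.fst
        rw [← mul_right_inj' hD]
        field_simp
        rw [hDdef]
        linear_combination p.fst * I_sq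
      · change -(I + v) * (D⁻¹ * ((t - v) * p.fst - (I - v) * p.snd)) +
          (t - v) * (D⁻¹ * ((I + v) * p.fst + (s - v) * p.snd)) = p.snd
        rw [← mul_right_inj' hD]
        field_simp
        rw [hDdef]
        linear_combination p.snd * I_sq))
  refine ⟨h1, h2.trans ?_⟩
  congr 2
  refine (FSystem.mul_K_adjoint (Φ₁ := basicController s) (Φ₂ := basicController t) _).trans ?_
  refine (congrArg₂ (· + ·) (basicController_K_adjoint s _) (basicController_K_adjoint t _)).trans ?_
  change D⁻¹ * ((t - v) * 1 - (I - v) * 1) + D⁻¹ * ((I + v) * 1 + (s - v) * 1) = _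
  field_simp
  ring

/-- Where it is undefined, the impedance takes the default value `0`, which is not in the open
half-plane. -/
theorem RiggedArray.impedanceDefinedAt_of_isDonoghue {S : RiggedArray V H ℂ}
    (hS : IsDonoghue S.scalarImpedance) {z : ℂ} (hz : 0 < z.im) : S.ImpedanceDefinedAt z := by
  by_contra h
  have h1 : S.scalarImpedance z = 0 := by rw [scalarImpedance, impedance, dif_neg h]
  have h2 := hS.2.1 z hz
  rw [h1] at h2
  simp at h2

end Controllers

theorem Real.tan_three_pi_div_four : Real.tan (3 * Real.pi / 4) = -1 := by
  rw [show 3 * Real.pi / 4 = Real.pi - Real.pi / 4 by ring, Real.tan_pi_sub, Real.tan_pi_div_four]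

theorem theorem6p4 {H : Type*} [NormedAddCommGroup H] [InnerProductSpace ℂ H] [CompleteSpace H]
    (Θ : LSystem H ℂ (1 : ℂ →L[ℂ] ℂ)) (hΘ : IsDonoghue Θ.toArray.scalarImpedance)
    (α : ℝ) (hα : α ∈ Set.Ico 0 Real.pi) :
    (∀ z : ℂ, 0 < z.im → (Θ.coupling (controller α)).ImpedanceDefinedAt z) ∧
      IsDonoghue (Θ.coupling (controller α)).scalarImpedance := by
  have hdef (z : ℂ) (hz : 0 < z.im) := RiggedArray.impedanceDefinedAt_of_isDonoghue hΘ hz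
  have hF : Θ.toArray.F = 1 := rfl
  have hne (z : ℂ) (hz : 0 < z.im) (t : ℝ) : (t : ℂ) - Θ.toArray.scalarImpedance z ≠ 0 :=
    ofReal_sub_ne_zero (hΘ.2.1 z hz) t
  unfold LSystem.coupling
  rcases eq_or_ne α 0 with h0 | h0
  · have hc : controller α = (basicController (-1)).mul (basicController (-1)) := by
      rw [controller, if_pos h0, Real.tan_three_pi_div_four]
    rw [hc]
    have hne0 (z : ℂ) (hz : 0 < z.im) : Θ.toArray.scalarImpedance z ≠ 0 := by
      simpa using hne z hz 0
    have key (z : ℂ) (hz : 0 < z.im) :=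
      RiggedArray.couple_basicController_mul_impedance hF (hdef z hz) (s := -1) (t := -1) (by
        have := hne0 z hz
        push_cast
        norm_num
        exact this)
    -- The impedance is `-1 / v`, the square of the Möbius map with `t = -1`.
    refine ⟨fun z hz ↦ (key z hz).1, ((hΘ.moebius (-1)).moebius (-1)).congr fun z hz ↦ ?_⟩
    rw [(key z hz).2]
    have h2 := hne0 z hz
    have h3 := hne z hz (-1)
    push_cast at h3 ⊢
    have h4 := ofReal_sub_ne_zero ((hΘ.moebius (-1)).2.1 z hz) (-1)
    push_cast at h4
    generalize Θ.toArray.scalarImpedance z = v at *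
    have h5 : -1 - (-1 * v + 1) / (-1 - v) = 2 * v / (-1 - v) := by
      field_simp
      ring
    rw [h5]
    field_simp
    ring
  rcases eq_or_ne α (Real.pi / 2) with h1 | h1
  · have hc : controller α = (basicController 1).mul (basicController (-1)) := by
      rw [controller, if_neg h0, if_pos h1, Real.tan_three_pi_div_four, Real.tan_pi_div_four]
    rw [hc]
    have key (z : ℂ) (hz : 0 < z.im) :=
      RiggedArray.couple_basicController_mul_impedance hF (hdef z hz) (s := 1) (t := -1)
        (by push_cast; norm_num)
    -- Here `s + t = 0`, so the correction term vanishes and the impedance is unchanged.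
    refine ⟨fun z hz ↦ (key z hz).1, hΘ.congr fun z hz ↦ ?_⟩
    rw [(key z hz).2]
    simp
  · have hc : controller α = basicController (Real.tan α) := by
      rw [controller, if_neg h0, if_neg h1]
    rw [hc]
    have key (z : ℂ) (hz : 0 < z.im) :=
      RiggedArray.couple_basicController_impedance hF (hdef z hz) (hne z hz (Real.tan α))
    exact ⟨fun z hz ↦ (key z hz).1, (hΘ.moebius (Real.tan α)).congr fun z hz ↦ (key z hz).2⟩
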